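/- Let $k$ be a field. An element system with characters $\mathrm{ESC}(G,g_i,\chi_i;i\in J)$ consists of a group $G$, a set $J$, central elements $g_i\in Z(G)$ and group homomorphisms $\chi_i:G\to k^{\times}$ ($i\in J$). Its Hopf quiver $Q$ has vertex set $G$ and, for $x,y\in G$, one arrow $a^{(i)}_{y,x}$ from $x$ to $y$ for each $i\in J$ with $x^{-1}y=g_i$. The arrow space $kQ_1$ is a $kG$-Hopf bimodule via $h\cdot a^{(i)}_{y,x}=a^{(i)}_{hy,hx}$, $a^{(i)}_{y,x}\cdot h=\chi_i(h)\,a^{(i)}_{yh,xh}$, $\delta^-(a)=t(a)\otimes a$, $\delta^+(a)=a\otimes s(a)$. The semi-path Hopf algebra $kQ^s=kQ^s(G,g_i,\chi_i;i\in J)$ is the tensor algebra $T_{kG}(kQ_1)$ with $\Delta(h)=h\otimes h$ for $h\in G$ and $\Delta(a)=\delta^-(a)+\delta^+(a)$ for arrows $a$. Put $E_j=a^{(j)}_{g_j,1}$. Suppose the system is of local FL-free type, that is, the following are given. (1) A set $N$ and a disjoint decomposition $J=\bigcup_{u\in N}(J_u\cup J_u')$; put $J^{(1)}=\bigcup_uJ_u$,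 $J^{(2)}=\bigcup_uJ_u'$; and a bijection $\sigma:J^{(1)}\to J^{(2)}$ which maps $J_u$ bijectively onto $J_u'$ for every $u\in N$. (2) Elements $\xi_i\in G$ ($i\in J$) with $\xi_{\sigma(i)}=\xi_i^{-1}$, $g_i=g_{\sigma(i)}=\xi_i^2$ and $\chi_{\sigma(i)}(\xi_j)=\chi_i(\xi_j)^{-1}$ for $i,j\in J_u$, $u\in N$; and integers $r_{ij}=r_{\sigma(i),\sigma(j)}\geq 1$ for $i\neq j$ in $J^{(1)}$. (3) For all $u\in N$ and $i\neq j$ in $J_u$: $\chi_j(g_i)\chi_i(g_j)\chi_i(g_i)^{r_{ij}-1}=1$, $\chi_i(\xi_j)=\chi_j(\xi_i)$ and $\chi_i(\xi_i)^{r_{ij}-1}\chi_j(g_i)=1$. (4) $G$ is a free commutative group with basis $(\xi_i)_{i\in J^{(1)}}$. Assume moreover that $\chi_i(\xi_i)\neq\chi_i(\xi_i)^{-1}$ for all $i\in J^{(1)}$, so that the denominators below are non-zero. Let $\left[{r\atop m}\right]_q$ denote the value at $q$ of the Laurent polynomial $\frac{[r]!}{[m]!\,[r-m]!}$, where $[n]!=\prod_{l=1}^n[l]$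 and $[l]=\frac{q^l-q^{-l}}{q-q^{-1}}$. Call $(i,j)$ a Serre pair if $i\ne j$, $i,j\in J_u$ or $i,j\in J_u'$ for some $u\in N$, and $r_{ij}-1$ is smaller than the (possibly infinite) order of $\chi_i(g_i)$ in $k^\times$. Let $I$ be the two-sided ideal of $kQ^s$ generated by the elements $$\chi_j(\xi_i)E_iE_j-\chi_i(\xi_j)^{-1}E_jE_i-\delta_{\sigma(i),j}\frac{g_i^2-1}{\chi_i(\xi_i)-\chi_i(\xi_i)^{-1}}\qquad(i\in J_u,\ j\in J_u',\ u\in N)$$ and $$\sum_{m=0}^{r_{ij}}(-1)^m\left[{r_{ij}\atop m}\right]_{\chi_i(\xi_i^{-1})}E_i^{r_{ij}-m}E_jE_i^m\qquad((i,j)\text{ a Serre pair}).$$ Let $U$ be the $k$-algebra generated by $K_i,X_i$ ($i\in J$) with the relations $$X_iX_j-X_jX_i=\delta_{\sigma(i),j}\frac{K_i^2-K_i^{-2}}{\chi_i(\xi_i)-\chi_i(\xi_i)^{-1}}\quad(i\in J_u,\ j\in J_u',\ u\in N),$$ $$K_iK_{\sigma(i)}=K_{\sigma(i)}K_i=1\quad(i\in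 J^{(1)}),\qquad \chi_j(\xi_i)K_iX_j=X_jK_i,\quad K_iK_j=K_jK_i\quad(i,j\in J),$$ $$\sum_{m=0}^{r_{ij}}(-1)^m\left[{r_{ij}\atop m}\right]_{\chi_i(\xi_i^{-1})}X_i^{r_{ij}-m}X_jX_i^m=0\quad((i,j)\text{ a Serre pair}).$$ Then $I$ is a Hopf ideal of $kQ^s$; the algebra $U$ is a Hopf algebra with $\Delta(K_i)=K_i\otimes K_i$, $\varepsilon(K_i)=1$, $\varepsilon(X_i)=0$ for $i\in J$ and, for $j\in J^{(1)}$, $$\Delta(X_j)=X_j\otimes K_{\sigma(j)}+K_j\otimes X_j,\qquad \Delta(X_{\sigma(j)})=X_{\sigma(j)}\otimes K_{\sigma(j)}+K_j\otimes X_{\sigma(j)},$$ $$S(K_j)=K_{\sigma(j)},\qquad S(X_j)=-\chi_j(\xi_j)X_j,\qquad S(X_{\sigma(j)})=-\chi_{\sigma(j)}(\xi_j)X_{\sigma(j)};$$ and $kQ^s/I\cong U$ as Hopf algebras. -/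

import Mathlib

open scoped TensorProduct

/-! ## The tensor algebra of a bimodule -/

section BimoduleTensorAlgebra

variable (k A M : Type*) [CommRing k] [Ring A] [Algebra k A] [AddCommGroup M]
  [Module A M] [Module Aᵐᵒᵖ M]

/-- The relations which turn the free `k`-algebra on the disjoint union of the sets `A` and `M`
into the tensor algebra of the `A`-bimodule `M` over the (noncommutative) `k`-algebra `A`. -/
inductive BimoduleTensorRel : FreeAlgebra k (A ⊕ M) → FreeAlgebra k (A ⊕ M) → Prop
  | scalar (c : k) : BimoduleTensorRel (FreeAlgebra.ι k (Sum.inl (algebraMap k A c)))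
      (algebraMap k (FreeAlgebra k (A ⊕ M)) c)
  | add_left (a b : A) : BimoduleTensorRel (FreeAlgebra.ι k (Sum.inl (a + b)))
      (FreeAlgebra.ι k (Sum.inl a) + FreeAlgebra.ι k (Sum.inl b))
  | mul_left (a b : A) : BimoduleTensorRel (FreeAlgebra.ι k (Sum.inl (a * b)))
      (FreeAlgebra.ι k (Sum.inl a) * FreeAlgebra.ι k (Sum.inl b))
  | add_right (m n : M) : BimoduleTensorRel (FreeAlgebra.ι k (Sum.inr (m + n)))
      (FreeAlgebra.ι k (Sum.inr m) + FreeAlgebra.ι k (Sum.inr n))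
  | smul (a : A) (m : M) : BimoduleTensorRel (FreeAlgebra.ι k (Sum.inr (a • m)))
      (FreeAlgebra.ι k (Sum.inl a) * FreeAlgebra.ι k (Sum.inr m))
  | op_smul (a : A) (m : M) : BimoduleTensorRel (FreeAlgebra.ι k (Sum.inr (MulOpposite.op a • m)))
      (FreeAlgebra.ι k (Sum.inr m) * FreeAlgebra.ι k (Sum.inl a))

/-- The tensor algebra `T_A(M) = A ⊕ M ⊕ (M ⊗_A M) ⊕ ⋯` of an `A`-bimodule `M` (the right action
is the action of `Aᵐᵒᵖ`; both actions are meant to restrict to the same action of `k`), given by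
generators and relations. Its universal property is proved below
(`BimoduleTensorAlgebra.lift`, `BimoduleTensorAlgebra.hom_ext`). -/
def BimoduleTensorAlgebra : Type _ := RingQuot (BimoduleTensorRel k A M)

noncomputable instance : Ring (BimoduleTensorAlgebra k A M) :=
  inferInstanceAs (Ring (RingQuot (BimoduleTensorRel k A M)))

noncomputable instance : Algebra k (BimoduleTensorAlgebra k A M) :=
  inferInstanceAs (Algebra k (RingQuot (BimoduleTensorRel k A M)))

end BimoduleTensorAlgebra

namespace BimoduleTensorAlgebra

variable {k A M : Type*} [CommRing k] [Ring A] [Algebra k A] [AddCommGroup M]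
  [Module A M] [Module Aᵐᵒᵖ M]

/-- The class of a generator. -/
noncomputable def gen (x : A ⊕ M) : BimoduleTensorAlgebra k A M :=
  RingQuot.mkAlgHom k (BimoduleTensorRel k A M) (FreeAlgebra.ι k x)

variable (k A M) in
/-- The inclusion of the degree `0` part. -/
noncomputable def incl₀ : A →ₐ[k] BimoduleTensorAlgebra k A M where
  toFun a := gen (Sum.inl a)
  map_one' := by
    have h := RingQuot.mkAlgHom_rel k (BimoduleTensorRel.scalar (k := k) (A := A) (M := M) 1)
    simp only [map_one] at h
    exact h
  map_mul' a b := by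
    have h := RingQuot.mkAlgHom_rel k (BimoduleTensorRel.mul_left (k := k) (A := A) (M := M) a b)
    rw [map_mul] at h
    exact h
  map_zero' := by
    have h := RingQuot.mkAlgHom_rel k (BimoduleTensorRel.scalar (k := k) (A := A) (M := M) 0)
    simp only [map_zero] at h
    exact h
  map_add' a b := by
    have h := RingQuot.mkAlgHom_rel k (BimoduleTensorRel.add_left (k := k) (A := A) (M := M) a b)
    rw [map_add] at h
    exact h
  commutes' c := by
    have h := RingQuot.mkAlgHom_rel k (BimoduleTensorRel.scalar (k := k) (A := A) (M := M) c)
    rw [AlgHom.commutes] at h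
    exact h

variable (k A M) in
/-- The inclusion of the degree `1` part. -/
noncomputable def incl₁ : M →+ BimoduleTensorAlgebra k A M :=
  AddMonoidHom.mk' (fun m => gen (Sum.inr m)) fun a b => by
    have h := RingQuot.mkAlgHom_rel k (BimoduleTensorRel.add_right (k := k) (A := A) (M := M) a b)
    rw [map_add] at h
    exact h

theorem incl₁_smul (a : A) (m : M) : incl₁ k A M (a • m) = incl₀ k A M a * incl₁ k A M m := by
  have h := RingQuot.mkAlgHom_rel k (BimoduleTensorRel.smul (k := k) (A := A) (M := M) a m)
  rw [map_mul] at h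
  exact h

theorem incl₁_op_smul (a : A) (m : M) :
    incl₁ k A M (MulOpposite.op a • m) = incl₁ k A M m * incl₀ k A M a := by
  have h := RingQuot.mkAlgHom_rel k (BimoduleTensorRel.op_smul (k := k) (A := A) (M := M) a m)
  rw [map_mul] at h
  exact h

section

variable {B : Type*} [Ring B] [Algebra k B]

/-- The universal property, existence part: an algebra map `φ` from `A` and a map `ψ` of
`A`-bimodules from `M` extend to the tensor algebra. -/
noncomputable def lift (φ : A →ₐ[k] B) (ψ : M →+ B) (hl : ∀ a m, ψ (a • m) = φ a * ψ m)
    (hr : ∀ a m, ψ (MulOpposite.op a • m) = ψ m * φ a) : BimoduleTensorAlgebra k A M →ₐ[k] B :=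
  RingQuot.liftAlgHom k ⟨FreeAlgebra.lift k (Sum.elim φ ψ), by
    intro x y h
    induction h <;> simp [hl, hr]⟩

theorem lift_incl₀ (φ : A →ₐ[k] B) (ψ : M →+ B) (hl : ∀ a m, ψ (a • m) = φ a * ψ m)
    (hr : ∀ a m, ψ (MulOpposite.op a • m) = ψ m * φ a) (a : A) :
    lift φ ψ hl hr (incl₀ k A M a) = φ a := by
  refine (RingQuot.liftAlgHom_mkAlgHom_apply k _ _ _).trans ?_
  simp

theorem lift_incl₁ (φ : A →ₐ[k] B) (ψ : M →+ B) (hl : ∀ a m, ψ (a • m) = φ a * ψ m)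
    (hr : ∀ a m, ψ (MulOpposite.op a • m) = ψ m * φ a) (m : M) :
    lift φ ψ hl hr (incl₁ k A M m) = ψ m := by
  refine (RingQuot.liftAlgHom_mkAlgHom_apply k _ _ _).trans ?_
  simp

/-- The universal property, uniqueness part. -/
theorem hom_ext {f f' : BimoduleTensorAlgebra k A M →ₐ[k] B}
    (h₀ : ∀ a, f (incl₀ k A M a) = f' (incl₀ k A M a))
    (h₁ : ∀ m, f (incl₁ k A M m) = f' (incl₁ k A M m)) : f = f' := by
  apply RingQuot.ringQuot_ext'
  ext x
  rcases x with a | m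
  · exact h₀ a
  · exact h₁ m

end

end BimoduleTensorAlgebra

/-! ## Hopf algebra structures on a given algebra -/

/-- A Hopf algebra structure on a given `k`-algebra `A` (as data on top of the algebra). -/
structure HopfStructure (k A : Type*) [CommRing k] [Ring A] [Algebra k A] where
  /-- the comultiplication -/
  comul : A →ₐ[k] A ⊗[k] A
  /-- the counit -/
  counit : A →ₐ[k] k
  /-- the antipode -/
  antipode : A →ₗ[k] A
  coassoc : (Algebra.TensorProduct.assoc k k k A A A).toAlgHom.comp
      ((Algebra.TensorProduct.map comul (.id k A)).comp comul)
      = (Algebra.TensorProduct.map (.id k A) comul).comp comul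
  rTensor_counit : (Algebra.TensorProduct.map counit (.id k A)).comp comul
      = (Algebra.TensorProduct.lid k A).symm
  lTensor_counit : (Algebra.TensorProduct.map (.id k A) counit).comp comul
      = (Algebra.TensorProduct.rid k k A).symm
  antipode_left : ∀ a, LinearMap.mul' k A (antipode.rTensor A (comul a))
      = algebraMap k A (counit a)
  antipode_right : ∀ a, LinearMap.mul' k A (antipode.lTensor A (comul a))
      = algebraMap k A (counit a)

/-- The corresponding bundled Hopf algebra. -/
noncomputable abbrev HopfStructure.toHopfAlgebra {k A : Type*} [CommRing k] [Ring A] [Algebra k A]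
    (H : HopfStructure k A) : HopfAlgebra k A :=
  { Bialgebra.ofAlgHom H.comul H.counit H.coassoc H.rTensor_counit H.lTensor_counit with
    antipode := H.antipode
    mul_antipode_rTensor_comul := LinearMap.ext H.antipode_left
    mul_antipode_lTensor_comul := LinearMap.ext H.antipode_right }

/-! ## Element systems with characters and their semi-path Hopf algebras -/

/-- An element system with characters `(G, g_i, χ_i; i ∈ J)` over `k`. -/
structure ESC (k G J : Type*) [Field k] [Group G] where
  /-- the central elements `g_i` -/
  g : J → G
  g_mem_center : ∀ i, g i ∈ Subgroup.center G
  /-- the characters `χ_i` -/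
  χ : J → G →* kˣ

namespace ESC

variable {k G J : Type*} [Field k] [Group G] (E : ESC k G J)

theorem g_comm (i : J) (h : G) : h * E.g i = E.g i * h :=
  Subgroup.mem_center_iff.1 (E.g_mem_center i) h

/-- The arrows of the Hopf quiver of the system: its vertices are the elements of `G`, and the
arrows from `x` to `y` are the `a_{y,x}^{(i)}` with `i ∈ J` and `x⁻¹ y = g_i`. Such an arrow is
recorded by its start vertex `x` and its label `i`. -/
@[ext]
structure Arrow (E : ESC k G J) where
  /-- the start vertex -/
  src : G
  /-- the label -/
  idx : J

/-- The end vertex of an arrow. -/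
def Arrow.tgt {E : ESC k G J} (a : E.Arrow) : G := a.src * E.g a.idx

/-- `h · a_{y,x}^{(i)} = a_{hy,hx}^{(i)}` on arrows. -/
def Arrow.left {E : ESC k G J} (h : G) (a : E.Arrow) : E.Arrow := ⟨h * a.src, a.idx⟩

/-- `a_{yh,xh}^{(i)}`, for the arrow `a_{y,x}^{(i)}`. -/
def Arrow.right {E : ESC k G J} (h : G) (a : E.Arrow) : E.Arrow := ⟨a.src * h, a.idx⟩

/-- The arrow space `kQ_1`, with the arrows as a basis. -/
def ArrowSpace (E : ESC k G J) : Type _ := E.Arrow →₀ k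

noncomputable instance : AddCommGroup E.ArrowSpace := inferInstanceAs (AddCommGroup (E.Arrow →₀ k))
noncomputable instance : Module k E.ArrowSpace := inferInstanceAs (Module k (E.Arrow →₀ k))

/-- An arrow as a basis vector of the arrow space. -/
noncomputable def vec {E : ESC k G J} (a : E.Arrow) : E.ArrowSpace :=
  (Finsupp.single a (1 : k) : E.Arrow →₀ k)

/-- The linear extension to the arrow space of a map on arrows. -/
noncomputable def ext {V : Type*} [AddCommGroup V] [Module k V] (f : E.Arrow → V) :
    E.ArrowSpace →ₗ[k] V :=
  Finsupp.linearCombination k f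

theorem ext_vec {V : Type*} [AddCommGroup V] [Module k V] (f : E.Arrow → V) (a : E.Arrow) :
    E.ext f (vec a) = f a :=
  (Finsupp.linearCombination_single k (1 : k) a).trans (one_smul k (f a))

variable {E} in
theorem arrowSpace_hom_ext {V : Type*} [AddCommGroup V] [Module k V]
    {f f' : E.ArrowSpace →ₗ[k] V} (h : ∀ a : E.Arrow, f (vec a) = f' (vec a)) : f = f' :=
  Finsupp.lhom_ext' fun a => LinearMap.ext_ring (h a)

/-- The left action of `G` on the arrow space, `h · a_{y,x}^{(i)} = a_{hy,hx}^{(i)}`. -/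
noncomputable def leftAct : G →* Module.End k E.ArrowSpace where
  toFun h := E.ext fun a => vec (a.left h)
  map_one' := arrowSpace_hom_ext fun a => by simp [ext_vec, Arrow.left]
  map_mul' h h' := arrowSpace_hom_ext fun a => by simp [ext_vec, Arrow.left, mul_assoc]

/-- The right action of `G` on the arrow space,
`a_{y,x}^{(i)} · h = χ_i(h) a_{yh,xh}^{(i)}`. -/
noncomputable def rightAct : G →* (Module.End k E.ArrowSpace)ᵐᵒᵖ where
  toFun h := MulOpposite.op (E.ext fun a => (E.χ a.idx h : k) • vec (a.right h))
  map_one' := MulOpposite.unop_injective <| arrowSpace_hom_ext fun a => by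
    simp [ext_vec, Arrow.right]
  map_mul' h h' := MulOpposite.unop_injective <| arrowSpace_hom_ext fun a => by
    simp [ext_vec, Arrow.right, mul_assoc, smul_smul]

noncomputable instance : Module (MonoidAlgebra k G) E.ArrowSpace :=
  Module.compHom _ (MonoidAlgebra.lift k (Module.End k E.ArrowSpace) G E.leftAct).toRingHom

noncomputable instance : Module (MonoidAlgebra k G)ᵐᵒᵖ E.ArrowSpace :=
  Module.compHom _ (((RingEquiv.opOp (Module.End k E.ArrowSpace)).symm.toRingHom.comp
    (RingHom.op (MonoidAlgebra.lift k (Module.End k E.ArrowSpace)ᵐᵒᵖ G E.rightAct).toRingHom)) :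
      (MonoidAlgebra k G)ᵐᵒᵖ →+* Module.End k E.ArrowSpace)

theorem smul_def (a : MonoidAlgebra k G) (m : E.ArrowSpace) :
    a • m = MonoidAlgebra.lift k (Module.End k E.ArrowSpace) G E.leftAct a m := rfl

theorem op_smul_def (a : MonoidAlgebra k G) (m : E.ArrowSpace) :
    MulOpposite.op a • m =
      (MonoidAlgebra.lift k (Module.End k E.ArrowSpace)ᵐᵒᵖ G E.rightAct a).unop m := rfl

/-- The two actions commute, so that the arrow space is a `kG`-bimodule. -/
instance : SMulCommClass (MonoidAlgebra k G) (MonoidAlgebra k G)ᵐᵒᵖ E.ArrowSpace where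
  smul_comm a b m := by
    obtain ⟨b, rfl⟩ := MulOpposite.op_surjective b
    simp only [smul_def, op_smul_def]
    induction a using MonoidAlgebra.induction_on with
    | of h =>
      induction b using MonoidAlgebra.induction_on with
      | of h' =>
        rw [MonoidAlgebra.lift_of, MonoidAlgebra.lift_of]
        have : E.leftAct h * (E.rightAct h').unop = (E.rightAct h').unop * E.leftAct h :=
          arrowSpace_hom_ext fun a => by
            simp [leftAct, rightAct, ext_vec, Arrow.left, Arrow.right, mul_assoc]
        exact LinearMap.congr_fun this m
      | add x y hx hy => simp only [map_add, MulOpposite.unop_add, LinearMap.add_apply, hx, hy]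
      | smul c x hx => simp only [map_smul, MulOpposite.unop_smul, LinearMap.smul_apply, hx]
    | add x y hx hy => simp only [map_add, LinearMap.add_apply, hx, hy]
    | smul c x hx => simp only [map_smul, LinearMap.smul_apply, hx]

theorem of_smul_vec (h : G) (a : E.Arrow) :
    MonoidAlgebra.of k G h • (vec a : E.ArrowSpace) = vec (a.left h) := by
  rw [smul_def, MonoidAlgebra.lift_of]
  exact E.ext_vec _ a

theorem op_of_smul_vec (h : G) (a : E.Arrow) :
    MulOpposite.op (MonoidAlgebra.of k G h) • (vec a : E.ArrowSpace)
      = (E.χ a.idx h : k) • vec (a.right h) := by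
  rw [op_smul_def, MonoidAlgebra.lift_of]
  exact E.ext_vec _ a

/-- The semi-path algebra `kQ^s = T_{kG}(kQ_1)` of the system. -/
abbrev SemiPath : Type _ := BimoduleTensorAlgebra k (MonoidAlgebra k G) E.ArrowSpace

/-- A group element as an element of the semi-path algebra. -/
noncomputable def grp : G →* E.SemiPath :=
  (BimoduleTensorAlgebra.incl₀ k (MonoidAlgebra k G) E.ArrowSpace : _ →* E.SemiPath).comp
    (MonoidAlgebra.of k G)

/-- An arrow as an element of the semi-path algebra. -/
noncomputable def arr (a : E.Arrow) : E.SemiPath :=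
  BimoduleTensorAlgebra.incl₁ k (MonoidAlgebra k G) E.ArrowSpace (vec a)

/-- The element `E_j = a_{g_j,1}^{(j)}`. -/
noncomputable def gen (j : J) : E.SemiPath := E.arr ⟨1, j⟩

theorem incl₁_smul_base (c : k) (m : E.ArrowSpace) :
    BimoduleTensorAlgebra.incl₁ k (MonoidAlgebra k G) E.ArrowSpace (c • m)
      = c • BimoduleTensorAlgebra.incl₁ k (MonoidAlgebra k G) E.ArrowSpace m := by
  have h : c • m = algebraMap k (MonoidAlgebra k G) c • m := by
    rw [smul_def, AlgHom.commutes]; rfl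
  rw [h, BimoduleTensorAlgebra.incl₁_smul, Algebra.smul_def]
  exact congrArg (· * _) ((BimoduleTensorAlgebra.incl₀ k (MonoidAlgebra k G) E.ArrowSpace).commutes c)

theorem grp_mul_arr (h : G) (a : E.Arrow) : E.grp h * E.arr a = E.arr (a.left h) :=
  ((BimoduleTensorAlgebra.incl₁_smul (k := k) (MonoidAlgebra.of k G h) (vec a : E.ArrowSpace)).symm.trans
    (congrArg _ (E.of_smul_vec h a)) :)

theorem arr_mul_grp (h : G) (a : E.Arrow) :
    E.arr a * E.grp h = (E.χ a.idx h : k) • E.arr (a.right h) :=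
  ((BimoduleTensorAlgebra.incl₁_op_smul (k := k) (MonoidAlgebra.of k G h)
      (vec a : E.ArrowSpace)).symm.trans
    ((congrArg _ (E.op_of_smul_vec h a)).trans (E.incl₁_smul_base _ _)) :)

section lift

variable {B : Type*} [Ring B] [Algebra k B]

/-- An algebra map out of the semi-path algebra, from its values on `G` and on the arrows. -/
noncomputable def lift (φ : G →* B) (ψ : E.Arrow → B)
    (hl : ∀ h a, ψ (a.left h) = φ h * ψ a)
    (hr : ∀ h (a : E.Arrow), (E.χ a.idx h : k) • ψ (a.right h) = ψ a * φ h) :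
    E.SemiPath →ₐ[k] B :=
  BimoduleTensorAlgebra.lift (MonoidAlgebra.lift k B G φ) (E.ext ψ).toAddMonoidHom
    (by
      intro a m
      change E.ext ψ (a • m) = _ * E.ext ψ m
      rw [smul_def]
      induction a using MonoidAlgebra.induction_on with
      | of h =>
        rw [MonoidAlgebra.lift_of, MonoidAlgebra.lift_of]
        have : E.ext ψ ∘ₗ E.leftAct h = LinearMap.mulLeft k (φ h) ∘ₗ E.ext ψ :=
          arrowSpace_hom_ext fun a => by
            have : E.leftAct h (vec a) = vec (a.left h) := E.ext_vec _ a
            simp [this, ext_vec, hl]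
        exact LinearMap.congr_fun this m
      | add x y hx hy => rw [map_add, map_add, LinearMap.add_apply, map_add, hx, hy, add_mul]
      | smul c x hx => rw [map_smul, map_smul, LinearMap.smul_apply, map_smul, hx, smul_mul_assoc])
    (by
      intro a m
      change E.ext ψ (MulOpposite.op a • m) = E.ext ψ m * _
      rw [op_smul_def]
      induction a using MonoidAlgebra.induction_on with
      | of h =>
        rw [MonoidAlgebra.lift_of, MonoidAlgebra.lift_of]
        have : E.ext ψ ∘ₗ (E.rightAct h).unop = LinearMap.mulRight k (φ h) ∘ₗ E.ext ψ :=
          arrowSpace_hom_ext fun a => by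
            have : (E.rightAct h).unop (vec a) = (E.χ a.idx h : k) • vec (a.right h) :=
              E.ext_vec _ a
            simp [this, ext_vec, hr]
        exact LinearMap.congr_fun this m
      | add x y hx hy =>
        rw [map_add, map_add, MulOpposite.unop_add, LinearMap.add_apply, map_add, hx, hy, mul_add]
      | smul c x hx =>
        rw [map_smul, map_smul, MulOpposite.unop_smul, LinearMap.smul_apply, map_smul, hx,
          mul_smul_comm])

theorem lift_grp (φ : G →* B) (ψ : E.Arrow → B) (hl : ∀ h a, ψ (a.left h) = φ h * ψ a)
    (hr : ∀ h (a : E.Arrow), (E.χ a.idx h : k) • ψ (a.right h) = ψ a * φ h) (h : G) :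
    E.lift φ ψ hl hr (E.grp h) = φ h :=
  (BimoduleTensorAlgebra.lift_incl₀ _ _ _ _ _).trans (MonoidAlgebra.lift_of _ _)

theorem lift_arr (φ : G →* B) (ψ : E.Arrow → B) (hl : ∀ h a, ψ (a.left h) = φ h * ψ a)
    (hr : ∀ h (a : E.Arrow), (E.χ a.idx h : k) • ψ (a.right h) = ψ a * φ h) (a : E.Arrow) :
    E.lift φ ψ hl hr (E.arr a) = ψ a :=
  (BimoduleTensorAlgebra.lift_incl₁ _ _ _ _ _).trans (E.ext_vec ψ a)

variable {E} in
theorem hom_ext {f f' : E.SemiPath →ₐ[k] B} (h₀ : ∀ h, f (E.grp h) = f' (E.grp h))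
    (h₁ : ∀ a, f (E.arr a) = f' (E.arr a)) : f = f' := by
  refine BimoduleTensorAlgebra.hom_ext (fun x => ?_) (fun m => ?_)
  · have : f.comp (BimoduleTensorAlgebra.incl₀ k (MonoidAlgebra k G) E.ArrowSpace)
        = f'.comp (BimoduleTensorAlgebra.incl₀ k (MonoidAlgebra k G) E.ArrowSpace) :=
      (MonoidAlgebra.lift k B G).symm.injective (MonoidHom.ext h₀)
    exact DFunLike.congr_fun this x
  · let i : E.ArrowSpace →ₗ[k] E.SemiPath :=
      { BimoduleTensorAlgebra.incl₁ k (MonoidAlgebra k G) E.ArrowSpace with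
        map_smul' := E.incl₁_smul_base }
    have : f.toLinearMap ∘ₗ i = f'.toLinearMap ∘ₗ i := arrowSpace_hom_ext h₁
    exact LinearMap.congr_fun this m

end lift

/-- An induction principle for the semi-path algebra. -/
theorem induction {P : E.SemiPath → Prop} (hs : ∀ c : k, P (algebraMap k _ c))
    (hg : ∀ h, P (E.grp h)) (ha : ∀ a, P (E.arr a)) (hadd : ∀ x y, P x → P y → P (x + y))
    (hmul : ∀ x y, P x → P y → P (x * y)) (x : E.SemiPath) : P x := by
  let S : Subalgebra k E.SemiPath :=
    { carrier := {x | P x}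
      mul_mem' := fun {x y} hx hy => hmul x y hx hy
      add_mem' := fun {x y} hx hy => hadd x y hx hy
      algebraMap_mem' := hs }
  let F : E.SemiPath →ₐ[k] S := E.lift
    { toFun := fun h => ⟨E.grp h, hg h⟩
      map_one' := Subtype.ext (map_one _)
      map_mul' := fun _ _ => Subtype.ext (map_mul _ _ _) }
    (fun a => ⟨E.arr a, ha a⟩)
    (fun h a => Subtype.ext (E.grp_mul_arr h a).symm)
    (fun h a => Subtype.ext (E.arr_mul_grp h a).symm)
  have : S.val.comp F = AlgHom.id k _ :=
    hom_ext (fun h => congrArg Subtype.val (E.lift_grp _ _ _ _ h))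
      (fun a => congrArg Subtype.val (E.lift_arr _ _ _ _ a))
  rw [← show S.val (F x) = x from DFunLike.congr_fun this x]
  exact (F x).2

/-! ### The Hopf algebra structure of the semi-path algebra -/

theorem left_tgt (h : G) (a : E.Arrow) : (a.left h).tgt = h * a.tgt := mul_assoc _ _ _

theorem right_tgt (h : G) (a : E.Arrow) : (a.right h).tgt = a.tgt * h := by
  simp only [Arrow.tgt, Arrow.right, mul_assoc]
  rw [E.g_comm]

/-- The group homomorphism `h ↦ h ⊗ h`. -/
noncomputable def comulGrp : G →* E.SemiPath ⊗[k] E.SemiPath where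
  toFun h := E.grp h ⊗ₜ E.grp h
  map_one' := by simp only [map_one]; rfl
  map_mul' _ _ := by simp only [map_mul, Algebra.TensorProduct.tmul_mul_tmul]

theorem comulGrp_apply (h : G) : E.comulGrp h = E.grp h ⊗ₜ E.grp h := rfl

/-- The comultiplication: `Δ(h) = h ⊗ h` for `h ∈ G`, and `Δ(a) = t(a) ⊗ a + a ⊗ s(a)` for an
arrow `a`, i.e. `Δ` on `kQ_1` is the sum of the two coactions of the arrow comodule. -/
noncomputable def comulHom : E.SemiPath →ₐ[k] E.SemiPath ⊗[k] E.SemiPath :=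
  E.lift E.comulGrp
    (fun a => E.grp a.tgt ⊗ₜ E.arr a + E.arr a ⊗ₜ E.grp a.src)
    (fun h a => by
      simp only [left_tgt, comulGrp_apply, mul_add,
        Algebra.TensorProduct.tmul_mul_tmul, grp_mul_arr, map_mul]
      rw [show (a.left h).src = h * a.src from rfl, map_mul])
    (fun h a => by
      simp only [right_tgt, comulGrp_apply, add_mul, smul_add,
        Algebra.TensorProduct.tmul_mul_tmul, arr_mul_grp, map_mul, TensorProduct.tmul_smul,
        ← TensorProduct.smul_tmul']
      rw [show (a.right h).src = a.src * h from rfl, map_mul])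

/-- The counit: `ε(h) = 1` for `h ∈ G`, and `ε(a) = 0` for an arrow `a`. -/
noncomputable def counitHom : E.SemiPath →ₐ[k] k :=
  E.lift 1 (fun _ => 0) (fun _ _ => by simp) (fun _ _ => by simp)

/-- The antipode, as an algebra map to the opposite algebra: `S(h) = h⁻¹` for `h ∈ G`, and
`S(a) = - t(a)⁻¹ · a · s(a)⁻¹` for an arrow `a`. -/
noncomputable def antipodeHom : E.SemiPath →ₐ[k] E.SemiPathᵐᵒᵖ :=
  E.lift
    { toFun := fun h => MulOpposite.op (E.grp h⁻¹)
      map_one' := by simp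
      map_mul' := fun _ _ => by simp [← MulOpposite.op_mul] }
    (fun a => MulOpposite.op (-(E.grp a.tgt⁻¹ * E.arr a * E.grp a.src⁻¹)))
    (fun h a => by
      simp only [left_tgt, MonoidHom.coe_mk, OneHom.coe_mk, ← MulOpposite.op_mul, neg_mul]
      congr 2
      rw [← grp_mul_arr, show (a.left h).src = h * a.src from rfl]
      simp only [mul_inv_rev, map_mul, mul_assoc]
      rw [← mul_assoc (E.grp h⁻¹) (E.grp h), ← map_mul, inv_mul_cancel, map_one, one_mul])
    (fun h a => by
      simp only [right_tgt, MonoidHom.coe_mk, OneHom.coe_mk, ← MulOpposite.op_mul, mul_neg,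
        ← MulOpposite.op_smul]
      rw [smul_neg]
      congr 2
      rw [← smul_mul_assoc, ← mul_smul_comm, ← arr_mul_grp,
        show (a.right h).src = a.src * h from rfl]
      simp only [mul_inv_rev, map_mul, mul_assoc]
      rw [← mul_assoc (E.grp h) (E.grp h⁻¹), ← map_mul, mul_inv_cancel, map_one, one_mul])

/-- The antipode as a linear map. -/
noncomputable def antipodeMap : E.SemiPath →ₗ[k] E.SemiPath :=
  (MulOpposite.opLinearEquiv k).symm.toLinearMap ∘ₗ E.antipodeHom.toLinearMap

theorem comulHom_grp (h : G) : E.comulHom (E.grp h) = E.grp h ⊗ₜ E.grp h := E.lift_grp _ _ _ _ h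

theorem comulHom_arr (a : E.Arrow) :
    E.comulHom (E.arr a) = E.grp a.tgt ⊗ₜ E.arr a + E.arr a ⊗ₜ E.grp a.src :=
  E.lift_arr _ _ _ _ a

theorem counitHom_grp (h : G) : E.counitHom (E.grp h) = 1 := E.lift_grp _ _ _ _ h

theorem counitHom_arr (a : E.Arrow) : E.counitHom (E.arr a) = 0 := E.lift_arr _ _ _ _ a

theorem antipodeMap_grp (h : G) : E.antipodeMap (E.grp h) = E.grp h⁻¹ :=
  congrArg MulOpposite.unop (E.lift_grp _ _ _ _ h)

theorem antipodeMap_arr (a : E.Arrow) :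
    E.antipodeMap (E.arr a) = -(E.grp a.tgt⁻¹ * E.arr a * E.grp a.src⁻¹) :=
  congrArg MulOpposite.unop (E.lift_arr _ _ _ _ a)

theorem antipodeMap_mul (x y : E.SemiPath) :
    E.antipodeMap (x * y) = E.antipodeMap y * E.antipodeMap x :=
  congrArg MulOpposite.unop (map_mul E.antipodeHom x y)

theorem antipodeMap_one : E.antipodeMap 1 = 1 :=
  congrArg MulOpposite.unop (map_one E.antipodeHom)

theorem antipode_left_aux (s t : E.SemiPath ⊗[k] E.SemiPath) (c : k)
    (h : LinearMap.mul' k _ (E.antipodeMap.rTensor _ t) = algebraMap k _ c) :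
    LinearMap.mul' k _ (E.antipodeMap.rTensor _ (t * s))
      = c • LinearMap.mul' k _ (E.antipodeMap.rTensor _ s) := by
  induction s with
  | zero => simp
  | add x y hx hy => rw [mul_add, map_add, map_add, hx, hy, map_add, map_add, smul_add]
  | tmul x y =>
    have key : ∀ t : E.SemiPath ⊗[k] E.SemiPath,
        LinearMap.mul' k _ (E.antipodeMap.rTensor _ (t * x ⊗ₜ y))
          = E.antipodeMap x * LinearMap.mul' k _ (E.antipodeMap.rTensor _ t) * y := by
      intro t
      induction t with
      | zero => simp
      | add a b ha hb => rw [add_mul, map_add, map_add, ha, hb, map_add, map_add, mul_add, add_mul]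
      | tmul a b => simp [antipodeMap_mul, mul_assoc]
    rw [key, h]
    simp [Algebra.algebraMap_eq_smul_one]

theorem antipode_right_aux (s t : E.SemiPath ⊗[k] E.SemiPath) (c : k)
    (h : LinearMap.mul' k _ (E.antipodeMap.lTensor _ s) = algebraMap k _ c) :
    LinearMap.mul' k _ (E.antipodeMap.lTensor _ (t * s))
      = c • LinearMap.mul' k _ (E.antipodeMap.lTensor _ t) := by
  induction t with
  | zero => simp
  | add x y hx hy => rw [add_mul, map_add, map_add, hx, hy, map_add, map_add, smul_add]
  | tmul x y =>
    have key : ∀ s : E.SemiPath ⊗[k] E.SemiPath,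
        LinearMap.mul' k _ (E.antipodeMap.lTensor _ (x ⊗ₜ y * s))
          = x * LinearMap.mul' k _ (E.antipodeMap.lTensor _ s) * E.antipodeMap y := by
      intro s
      induction s with
      | zero => simp
      | add a b ha hb => rw [mul_add, map_add, map_add, ha, hb, map_add, map_add, mul_add, add_mul]
      | tmul a b => simp [antipodeMap_mul, mul_assoc]
    rw [key, h]
    simp [Algebra.algebraMap_eq_smul_one]

/-- The Hopf algebra structure of the semi-path algebra. -/
noncomputable def hopf : HopfStructure k E.SemiPath where
  comul := E.comulHom
  counit := E.counitHom
  antipode := E.antipodeMap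
  coassoc := hom_ext
    (fun h => by simp [comulHom_grp])
    (fun a => by
      simp [comulHom_grp, comulHom_arr, TensorProduct.add_tmul, TensorProduct.tmul_add, add_assoc])
  rTensor_counit := hom_ext
    (fun h => by simp [comulHom_grp, counitHom_grp])
    (fun a => by simp [comulHom_arr, counitHom_grp, counitHom_arr])
  lTensor_counit := hom_ext
    (fun h => by simp [comulHom_grp, counitHom_grp])
    (fun a => by simp [comulHom_arr, counitHom_grp, counitHom_arr])
  antipode_left := by
    refine fun x => E.induction (P := fun x => LinearMap.mul' k _ (E.antipodeMap.rTensor _ (E.comulHom x))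
      = algebraMap k _ (E.counitHom x)) ?_ ?_ ?_ ?_ ?_ x
    · intro c
      simp [Algebra.algebraMap_eq_smul_one, Algebra.TensorProduct.one_def, antipodeMap_one]
    · intro h
      simp [comulHom_grp, antipodeMap_grp, counitHom_grp, ← map_mul]
    · intro a
      simp [comulHom_arr, antipodeMap_grp, antipodeMap_arr, counitHom_arr, mul_assoc, ← map_mul]
    · intro x y hx hy
      simp only [map_add, hx, hy]
    · intro x y hx hy
      rw [map_mul, E.antipode_left_aux _ _ _ hx, hy, map_mul, map_mul, Algebra.smul_def]
  antipode_right := by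
    refine fun x => E.induction (P := fun x => LinearMap.mul' k _ (E.antipodeMap.lTensor _ (E.comulHom x))
      = algebraMap k _ (E.counitHom x)) ?_ ?_ ?_ ?_ ?_ x
    · intro c
      simp [Algebra.algebraMap_eq_smul_one, Algebra.TensorProduct.one_def, antipodeMap_one]
    · intro h
      simp [comulHom_grp, antipodeMap_grp, counitHom_grp, ← map_mul]
    · intro a
      simp only [comulHom_arr, map_add, LinearMap.lTensor_tmul, LinearMap.mul'_apply,
        antipodeMap_grp, antipodeMap_arr, counitHom_arr, mul_neg, map_zero, ← mul_assoc]
      simp only [← map_mul, mul_inv_cancel, map_one, one_mul, neg_add_cancel]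
    · intro x y hx hy
      simp only [map_add, hx, hy]
    · intro x y hx hy
      rw [map_mul, E.antipode_right_aux _ _ _ hy, hx, map_mul, map_mul, Algebra.smul_def,
        Algebra.commutes]

/-- The semi-path Hopf algebra `kQ^s(G, g_i, χ_i; i ∈ J)`. -/
noncomputable instance : HopfAlgebra k E.SemiPath := E.hopf.toHopfAlgebra

end ESC

/-! ## Quantum binomial coefficients and quantum Serre elements -/

section Quantum

variable {k : Type*} [Field k]

/-- The `q`-number `[n]_q = (q^n - q^{-n}) / (q - q^{-1})`. -/
noncomputable def qNumber (q : k) (n : ℕ) : k := (q ^ n - q⁻¹ ^ n) / (q - q⁻¹)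

/-- The `q`-factorial `[n]_q! = [1]_q ⋯ [n]_q`. -/
noncomputable def qFactorial (q : k) (n : ℕ) : k := ∏ i ∈ Finset.range n, qNumber q (i + 1)

/-- The symmetric Gaussian binomial coefficient `[n choose m]_q`, the value at `q` of the Laurent
polynomial `[n]! / ([m]! [n - m]!)`, through its Pascal recursion. By `qBinom_eq_div` below it is
that quotient whenever the denominator does not vanish. -/
noncomputable def qBinom (q : k) : ℕ → ℕ → k
  | _, 0 => 1
  | 0, _ + 1 => 0
  | n + 1, m + 1 => q ^ (m + 1) * qBinom q n (m + 1) + q ^ ((m : ℤ) - n) * qBinom q n m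

theorem qBinom_zero_right (q : k) (n : ℕ) : qBinom q n 0 = 1 := by cases n <;> rfl

theorem qBinom_eq_zero (q : k) : ∀ n m : ℕ, n < m → qBinom q n m = 0
  | _, 0, h => absurd h (Nat.not_lt_zero _)
  | 0, _ + 1, _ => rfl
  | n + 1, m + 1, h => by
    rw [qBinom, qBinom_eq_zero q n (m + 1) (by omega), qBinom_eq_zero q n m (by omega)]
    simp

theorem qFactorial_succ (q : k) (n : ℕ) :
    qFactorial q (n + 1) = qFactorial q n * qNumber q (n + 1) := Finset.prod_range_succ _ _

theorem qNumber_add {q : k} (hq : q ≠ 0) (a b : ℕ) :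
    qNumber q (a + b) = q ^ a * qNumber q b + (q ^ b)⁻¹ * qNumber q a := by
  simp only [qNumber, inv_pow, pow_add]
  have h1 : q ^ a ≠ 0 := pow_ne_zero _ hq
  have h2 : q ^ b ≠ 0 := pow_ne_zero _ hq
  rw [← mul_div_assoc, ← mul_div_assoc, ← add_div]
  congr 1
  field_simp
  ring

theorem qBinom_mul {q : k} (hq : q ≠ 0) (hq2 : q - q⁻¹ ≠ 0) : ∀ m l : ℕ,
    qBinom q (m + l) m * (qFactorial q m * qFactorial q l) = qFactorial q (m + l)
  | 0, l => by simp [qBinom_zero_right, qFactorial]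
  | m + 1, 0 => by
    have h := qBinom_mul hq hq2 m 0
    have h0 : qFactorial q 0 = 1 := by simp [qFactorial]
    rw [Nat.add_zero, h0, mul_one] at h
    rw [Nat.add_zero, h0, mul_one, qBinom, qBinom_eq_zero q m (m + 1) (by omega), sub_self,
      zpow_zero, mul_zero, zero_add, one_mul, qFactorial_succ, ← mul_assoc, h]
  | m + 1, l + 1 => by
    have h1 := qBinom_mul hq hq2 (m + 1) l
    have h2 := qBinom_mul hq hq2 m (l + 1)
    rw [show m + 1 + (l + 1) = (m + 1 + l) + 1 by omega, qBinom, qFactorial_succ q (m + 1 + l),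
      show m + 1 + l + 1 = (m + 1) + (l + 1) by omega, qNumber_add hq]
    rw [show m + (l + 1) = m + 1 + l by omega] at h2
    have h3 : q ^ ((m : ℤ) - ((m + 1 + l : ℕ) : ℤ)) = (q ^ (l + 1))⁻¹ := by
      rw [← zpow_natCast, ← zpow_neg]
      congr 1
      push_cast
      ring
    rw [h3, mul_add, mul_left_comm, mul_left_comm _ (q ^ (l + 1))⁻¹]
    nth_rewrite 1 [← h1]
    rw [← h2, qFactorial_succ q m, qFactorial_succ q l]
    ring

theorem qBinom_eq_div {q : k} (hq : q ≠ 0) (hq2 : q - q⁻¹ ≠ 0) (n m : ℕ) (hm : m ≤ n)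
    (h : qFactorial q m * qFactorial q (n - m) ≠ 0) :
    qBinom q n m = qFactorial q n / (qFactorial q m * qFactorial q (n - m)) := by
  rw [eq_div_iff h]
  have := qBinom_mul hq hq2 m (n - m)
  rwa [Nat.add_sub_cancel' hm] at this

/-- The quantum Serre element `∑_{m=0}^r (-1)^m [r choose m]_q x^{r-m} y x^m`. -/
noncomputable def qSerre {A : Type*} [Ring A] [Algebra k A] (q : k) (r : ℕ) (x y : A) : A :=
  ∑ m ∈ Finset.range (r + 1), ((-1) ^ m * qBinom q r m) • (x ^ (r - m) * y * x ^ m)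

end Quantum

/-! ## Local FL-free type -/

/-- The data exhibiting an element system with characters as one of local FL-free type. -/
structure LocalFLFree {k G J : Type*} [Field k] [Group G] (E : ESC k G J) (N : Type*) where
  /-- the sets `J_u` -/
  P : N → Set J
  /-- the sets `J_u'` -/
  P' : N → Set J
  cover : ∀ i, ∃ u, i ∈ P u ∨ i ∈ P' u
  disjoint_P : ∀ u v, u ≠ v → Disjoint (P u) (P v)
  disjoint_P' : ∀ u v, u ≠ v → Disjoint (P' u) (P' v)
  disjoint_P_P' : ∀ u v, Disjoint (P u) (P' v)
  /-- the bijection `σ` from `J^(1) = ⋃ J_u` to `J^(2) = ⋃ J_u'`; its values outside `J^(1)` play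
  no role -/
  σ : J → J
  σ_bijOn : ∀ u, Set.BijOn σ (P u) (P' u)
  /-- the elements `ξ_i` -/
  ξ : J → G
  ξ_σ : ∀ u, ∀ i ∈ P u, ξ (σ i) = (ξ i)⁻¹
  χ_σ : ∀ u, ∀ i ∈ P u, ∀ j ∈ P u, E.χ (σ i) (ξ j) = (E.χ i (ξ j))⁻¹
  g_eq : ∀ u, ∀ i ∈ P u, E.g i = ξ i ^ 2
  g_σ : ∀ u, ∀ i ∈ P u, E.g (σ i) = ξ i ^ 2
  /-- the positive integers `r_{ij}` -/
  r : J → J → ℕ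
  r_pos : ∀ i ∈ ⋃ u, P u, ∀ j ∈ ⋃ u, P u, i ≠ j → 0 < r i j
  r_σ : ∀ i ∈ ⋃ u, P u, ∀ j ∈ ⋃ u, P u, i ≠ j → r (σ i) (σ j) = r i j
  χ_g_mul : ∀ u, ∀ i ∈ P u, ∀ j ∈ P u, i ≠ j →
    E.χ j (E.g i) * E.χ i (E.g j) * E.χ i (E.g i) ^ (r i j - 1) = 1
  χ_ξ_symm : ∀ u, ∀ i ∈ P u, ∀ j ∈ P u, i ≠ j → E.χ i (ξ j) = E.χ j (ξ i)
  /-- here `χ_i(ξ_i)` is the square root of `χ_i(g_i) = χ_i(ξ_i)^2` -/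
  χ_ξ_pow : ∀ u, ∀ i ∈ P u, ∀ j ∈ P u, i ≠ j → E.χ i (ξ i) ^ (r i j - 1) * E.χ j (E.g i) = 1
  /-- `G` is a free commutative group with basis `ξ_i`, `i ∈ J^(1)` -/
  free : ∃ e : G ≃* Multiplicative (FreeAbelianGroup (⋃ u, P u : Set J)),
    ∀ i : (⋃ u, P u : Set J), e (ξ i) = Multiplicative.ofAdd (FreeAbelianGroup.of i)

namespace LocalFLFree

variable {k G J N : Type*} [Field k] [Group G] {E : ESC k G J} (D : LocalFLFree E N)

/-- The set `J^(1)`. -/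
def J₁ : Set J := ⋃ u, D.P u

/-- The pairs `(i, j)` for which a quantum Serre relation is imposed: `i ≠ j`, both in `J_u` or
both in `J_u'` for some `u`, and `r_{ij} - 1` smaller than the order of `χ_i(g_i)` (the value `0` of
`orderOf` stands for infinite order). -/
def SerrePair (i j : J) : Prop :=
  (∃ u, (i ∈ D.P u ∧ j ∈ D.P u) ∨ (i ∈ D.P' u ∧ j ∈ D.P' u)) ∧ i ≠ j ∧
    (orderOf (E.χ i (E.g i)) = 0 ∨ D.r i j - 1 < orderOf (E.χ i (E.g i)))

/-- The scalar `χ_i(ξ_i) - χ_i(ξ_i)⁻¹`. -/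
noncomputable def den (i : J) : k := (E.χ i (D.ξ i) : k) - (E.χ i (D.ξ i) : k)⁻¹

open Classical in
/-- The element `χ_j(ξ_i) E_i E_j - χ_i(ξ_j)⁻¹ E_j E_i - δ_{σ(i),j} (g_i² - 1) / den i`. -/
noncomputable def commElt (i j : J) : E.SemiPath :=
  (E.χ j (D.ξ i) : k) • (E.gen i * E.gen j) - (E.χ i (D.ξ j) : k)⁻¹ • (E.gen j * E.gen i)
    - if D.σ i = j then (D.den i)⁻¹ • (E.grp (E.g i) ^ 2 - 1) else 0

/-- The two-sided ideal `I` of the semi-path Hopf algebra. -/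
noncomputable def I : Ideal E.SemiPath :=
  (TwoSidedIdeal.span
    ({x | ∃ u, ∃ i ∈ D.P u, ∃ j ∈ D.P' u, x = D.commElt i j} ∪
      {x | ∃ i j, D.SerrePair i j ∧
        x = qSerre (E.χ i (D.ξ i)⁻¹ : k) (D.r i j) (E.gen i) (E.gen j)})).asIdeal

instance : D.I.IsTwoSided := inferInstanceAs (TwoSidedIdeal.asIdeal _).IsTwoSided

/-! ### The algebra `U` -/

/-- The generator `K_i` of the free algebra. -/
noncomputable def freeK (k : Type*) [Field k] {J : Type*} (i : J) : FreeAlgebra k (J ⊕ J) :=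
  FreeAlgebra.ι k (Sum.inl i)

/-- The generator `X_i` of the free algebra. -/
noncomputable def freeX (k : Type*) [Field k] {J : Type*} (i : J) : FreeAlgebra k (J ⊕ J) :=
  FreeAlgebra.ι k (Sum.inr i)

open Classical in
/-- The defining relations of `U`; in the first one, `K_i^{-2}` is `K_{σ(i)}^2`. -/
inductive URel : FreeAlgebra k (J ⊕ J) → FreeAlgebra k (J ⊕ J) → Prop
  | comm (u : N) (i j : J) (hi : i ∈ D.P u) (hj : j ∈ D.P' u) :
      URel (freeX k i * freeX k j - freeX k j * freeX k i)
        (if D.σ i = j then (D.den i)⁻¹ • (freeK k i ^ 2 - freeK k (D.σ i) ^ 2) else 0)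
  | inv_right (i : J) (hi : i ∈ D.J₁) : URel (freeK k i * freeK k (D.σ i)) 1
  | inv_left (i : J) (hi : i ∈ D.J₁) : URel (freeK k (D.σ i) * freeK k i) 1
  | KX (i j : J) : URel ((E.χ j (D.ξ i) : k) • (freeK k i * freeX k j)) (freeX k j * freeK k i)
  | KK (i j : J) : URel (freeK k i * freeK k j - freeK k j * freeK k i) 0
  | serre (i j : J) (h : D.SerrePair i j) :
      URel (qSerre (E.χ i (D.ξ i)⁻¹ : k) (D.r i j) (freeX k i) (freeX k j)) 0

/-- The algebra `U`. -/
def U : Type _ := RingQuot D.URel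

noncomputable instance : Ring D.U := inferInstanceAs (Ring (RingQuot D.URel))
noncomputable instance : Algebra k D.U := inferInstanceAs (Algebra k (RingQuot D.URel))

/-- The generator `K_i` of `U`. -/
noncomputable def K (i : J) : D.U := RingQuot.mkAlgHom k D.URel (freeK k i)

/-- The generator `X_i` of `U`. -/
noncomputable def X (i : J) : D.U := RingQuot.mkAlgHom k D.URel (freeX k i)

/-- The prescribed values on the generators of the comultiplication, counit and antipode
of `U`. -/
structure IsStandard (H : HopfStructure k D.U) : Prop where
  comul_X : ∀ j ∈ D.J₁, H.comul (D.X j) = D.X j ⊗ₜ D.K (D.σ j) + D.K j ⊗ₜ D.X j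
  comul_X_σ : ∀ j ∈ D.J₁, H.comul (D.X (D.σ j)) =
    D.X (D.σ j) ⊗ₜ D.K (D.σ j) + D.K j ⊗ₜ D.X (D.σ j)
  comul_K : ∀ i, H.comul (D.K i) = D.K i ⊗ₜ D.K i
  counit_X : ∀ i, H.counit (D.X i) = 0
  counit_K : ∀ i, H.counit (D.K i) = 1
  antipode_X : ∀ j ∈ D.J₁, H.antipode (D.X j) = -((E.χ j (D.ξ j) : k) • D.X j)
  antipode_X_σ : ∀ j ∈ D.J₁,
    H.antipode (D.X (D.σ j)) = -((E.χ (D.σ j) (D.ξ j) : k) • D.X (D.σ j))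
  antipode_K : ∀ j ∈ D.J₁, H.antipode (D.K j) = D.K (D.σ j)

end LocalFLFree

/-! ### Symmetric Gaussian binomial coefficients. -/

section QuantumBinomial

variable {k : Type*} [Field k]

/-! The ideal `I` is generated by skew-primitive elements: each generator `x` satisfies `Δ x = a ⊗ x
+ x ⊗ 1` for some `a`, and the counit kills it. Such elements always generate a Hopf ideal
(`isHopfIdeal_span_of_skewPrimitive`), because the antipode axiom turns the formula for `Δ x` into
`S x = -S(a) x`.

Write `rt j` for the chosen square root of `g_j`; it equals `ξ_i` both for `j = i ∈ J_u` and for `j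
= σ i`. For a commutator relation the scalars `χ_j(ξ_i)` and `χ_i(ξ_j)⁻¹` are mutually inverse. This
cancels the mixed terms of the coproduct (`comul_braidedComm`), and `g_i² - 1` has the same
associated group-like `g_i g_j` when `j = σ i`. For a Serre relation put `s = χ_i(rt i)`, `r =
r_{ij}`. The axioms say that moving `E_i` past `g_i` costs `s²`, and moving `E_i` past `g_j` or
`E_j` past `g_i` costs `s^{1-r}`. The Serre element is the `r`-th of the iterated braided
commutators `z_n` of `E_i` with `E_j`. Their coproducts have a closed form (`comul_iterComm`) in
which every middle coefficient carries the factor `s^{n-r} - s^{r-n}`, so that only the two outer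
terms remain at `n = r`. No q-number is inverted, so `s` may be a root of unity.

For the isomorphism, set `X_j = E_j (rt j)⁻¹` and `K_i = ξ_i`. Moving all group elements to the
right turns each generator of `I` into the corresponding relation of `U`, times a nonzero scalar and
a group element (`comm_rescale`, `qSerre_rescale`). As `G` is free abelian on the `ξ_i`, the
elements `K_i` define a homomorphism from `G` to `U`; the two substitutions then give mutually
inverse algebra maps (`quotEquiv`). The Hopf structure of `U` is the transported one, and its values
on generators follow from `X_j = E_j (rt j)⁻¹`. -/

theorem qBinom_succ_succ (q : k) (n m : ℕ) :
    qBinom q (n + 1) (m + 1) = q ^ (m + 1) * qBinom q n (m + 1) + q ^ ((m : ℤ) - n) * qBinom q n m := by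
  rw [qBinom]

/-- The relation `[m+1] [n choose m+1] = [n-m] [n choose m]`, cleared of denominators. -/
theorem qBinom_succ_right {q : k} (hq : q ≠ 0) (n m : ℕ) :
    (q ^ ((m : ℤ) + 1) - q ^ (-(m : ℤ) - 1)) * qBinom q n (m + 1)
      = (q ^ ((n : ℤ) - m) - q ^ ((m : ℤ) - n)) * qBinom q n m := by
  induction n generalizing m with
  | zero =>
    cases m with
    | zero => simp [qBinom]
    | succ m => simp [qBinom]
  | succ n ih =>
    cases m with
    | zero =>
      have h := ih 0
      rw [qBinom_succ_succ, qBinom_zero_right, qBinom_zero_right]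
      rw [qBinom_zero_right] at h
      simp only [zero_add, Nat.cast_zero, neg_zero, zero_sub, sub_zero, mul_one, pow_one] at h ⊢
      push_cast
      simp only [neg_add_rev, zpow_add₀ hq, zpow_neg, zpow_one, zpow_natCast] at h ⊢
      linear_combination q * h
    | succ m =>
      have h1 := ih (m + 1)
      have h0 := ih m
      rw [qBinom_succ_succ q n (m + 1), qBinom_succ_succ q n m]
      push_cast at h1 h0 ⊢
      have e1 : q ^ (m + 1 + 1) = q ^ (m : ℤ) * q * q := by
        rw [zpow_natCast]; ring
      have e2 : q ^ (m + 1) = q ^ (m : ℤ) * q := by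
        rw [zpow_natCast]; ring
      rw [e1, e2]
      simp only [neg_add_rev, sub_eq_add_neg, zpow_add₀ hq, zpow_neg, zpow_one]
        at h0 h1 ⊢
      have hm : q ^ (m : ℤ) ≠ 0 := zpow_ne_zero _ hq
      have hn : q ^ (n : ℤ) ≠ 0 := zpow_ne_zero _ hq
      generalize q ^ (m : ℤ) = M at *
      generalize q ^ (n : ℤ) = T at *
      generalize qBinom q n (m + 1 + 1) = b2 at *
      generalize qBinom q n (m + 1) = b1 at *
      generalize qBinom q n m = b0 at *
      -- The weights are the Pascal coefficients `q^(m+2)` of `b2` and `q^(m-n)` of `b0`.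
      linear_combination (norm := skip) M * q * q * h1 + M * T⁻¹ * h0
      field_simp
      ring

/-- The second Pascal recursion of the symmetric Gaussian binomial coefficients. -/
theorem qBinom_succ_succ' {q : k} (hq : q ≠ 0) (n m : ℕ) :
    qBinom q (n + 1) (m + 1) = q ^ (-(m : ℤ) - 1) * qBinom q n (m + 1)
      + q ^ ((n : ℤ) - m) * qBinom q n m := by
  have h := qBinom_succ_right hq n m
  have e : q ^ (m + 1) = q ^ ((m : ℤ) + 1) := by rw [← zpow_natCast]; simp
  rw [qBinom_succ_succ, e]
  -- The difference of the two Pascal recursions is exactly `qBinom_succ_right`.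
  linear_combination h

/-- Replacing `q` by `q⁻¹` exchanges the two Pascal recursions. -/
theorem qBinom_inv {q : k} (hq : q ≠ 0) (n m : ℕ) : qBinom q⁻¹ n m = qBinom q n m := by
  induction n generalizing m with
  | zero => cases m <;> rfl
  | succ n ih =>
    cases m with
    | zero => rfl
    | succ m =>
      have e : q⁻¹ ^ (m + 1) = q ^ (-(m : ℤ) - 1) := by
        rw [← zpow_natCast, inv_zpow', Nat.cast_succ, neg_add']
      rw [qBinom_succ_succ, qBinom_succ_succ' hq, ih, ih, e, inv_zpow', neg_sub]

theorem qSerre_inv {A : Type*} [Ring A] [Algebra k A] {q : k} (hq : q ≠ 0) (r : ℕ) (x y : A) :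
    qSerre q⁻¹ r x y = qSerre q r x y := by
  simp only [qSerre, qBinom_inv hq]

end QuantumBinomial

/-! ### The coproduct of quantum Serre elements. -/

section SkewPrimitive

variable {k A : Type*} [Field k] [Ring A] [Algebra k A]

/-- The iterated braided commutators `z_{n+1} = x z_n - s^{r-1-2n} z_n x` with `z_0 = y`. -/
noncomputable def iterComm (s : k) (r : ℕ) (x y : A) : ℕ → A
  | 0 => y
  | n + 1 => x * iterComm s r x y n - s ^ ((r : ℤ) - 1 - 2 * n) • (iterComm s r x y n * x)

/-- Induction by the Pascal recursion. The extra power of `s` has exponent `m (r - n)`, which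
vanishes at `n = r`, so the last commutator is the Serre element. -/
theorem iterComm_eq_sum {s : k} (hs : s ≠ 0) (r : ℕ) (x y : A) (n : ℕ) :
    iterComm s r x y n = ∑ m ∈ Finset.range (n + 1),
      ((-1) ^ m * qBinom s n m * s ^ ((m : ℤ) * ((r : ℤ) - n))) • (x ^ (n - m) * y * x ^ m) := by
  induction n with
  | zero => simp [iterComm, qBinom_zero_right]
  | succ n ih =>
    -- A vanishing term `m = n + 1` is appended, so that after splitting off `m = 0` this sum is
    -- indexed like the one coming from `z_n x`.
    have hx : x * ∑ m ∈ Finset.range (n + 1),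
        ((-1) ^ m * qBinom s n m * s ^ ((m : ℤ) * ((r : ℤ) - n))) • (x ^ (n - m) * y * x ^ m)
        = ∑ m ∈ Finset.range (n + 2), ((-1) ^ m * qBinom s n m * s ^ ((m : ℤ) * ((r : ℤ) - n))) •
          (x ^ (n + 1 - m) * y * x ^ m) := by
      rw [Finset.sum_range_succ _ (n + 1), qBinom_eq_zero s n (n + 1) (by omega), Finset.mul_sum]
      simp only [mul_zero, zero_mul, zero_smul, add_zero]
      refine Finset.sum_congr rfl fun m hm => ?_
      rw [mul_smul_comm, Nat.succ_sub (Nat.lt_succ_iff.1 (Finset.mem_range.1 hm)), pow_succ']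
      simp only [mul_assoc]
    rw [iterComm, ih, hx, Finset.sum_mul, Finset.smul_sum, Finset.sum_range_succ' _ (n + 1),
      Finset.sum_range_succ' _ (n + 1), add_sub_right_comm, ← Finset.sum_sub_distrib]
    congr 1
    · refine Finset.sum_congr rfl fun m _ => ?_
      rw [smul_mul_assoc, mul_assoc _ (x ^ m) x, ← pow_succ, smul_smul, Nat.succ_sub_succ,
        ← sub_smul, qBinom_succ_succ]
      congr 1
      have e : s ^ (m + 1) = s ^ ((m : ℤ) + 1) := by rw [← zpow_natCast]; simp
      have e1 : s ^ (((m + 1 : ℕ) : ℤ) * ((r : ℤ) - n))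
          = s ^ (((m + 1 : ℕ) : ℤ) * ((r : ℤ) - (n + 1 : ℕ))) * s ^ ((m : ℤ) + 1) := by
        rw [← zpow_add₀ hs]; push_cast; ring_nf
      have e2 : s ^ ((r : ℤ) - 1 - 2 * n) * s ^ ((m : ℤ) * ((r : ℤ) - n))
          = s ^ (((m + 1 : ℕ) : ℤ) * ((r : ℤ) - (n + 1 : ℕ))) * s ^ ((m : ℤ) - n) := by
        rw [← zpow_add₀ hs, ← zpow_add₀ hs]; push_cast; ring_nf
      rw [e, e1, pow_succ]
      linear_combination (-1) * (-1) ^ m * qBinom s n m * e2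
    · simp [qBinom_zero_right]

theorem iterComm_self {s : k} (hs : s ≠ 0) (r : ℕ) (x y : A) :
    iterComm s r x y r = qSerre s r x y := by
  simp [iterComm_eq_sum hs, qSerre]

/-- The scalar `∏_{l<m} (s^{a-l} - s^{l-a}) s^{-l}`. -/
noncomputable def descScalar (s : k) (a : ℤ) (m : ℕ) : k :=
  s ^ (-(m.choose 2 : ℤ)) * ∏ l ∈ Finset.range m, (s ^ (a - l) - s ^ ((l : ℤ) - a))

theorem descScalar_succ {s : k} (hs : s ≠ 0) (a : ℤ) (m : ℕ) :
    descScalar s a (m + 1) = s ^ (-(m : ℤ)) * (s ^ (a - m) - s ^ (m - a)) * descScalar s a m := by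
  rw [descScalar, descScalar, Finset.prod_range_succ, Nat.choose_succ_succ' m 1, Nat.choose_one_right,
    Nat.cast_add, neg_add, zpow_add₀ hs]
  ring

theorem descScalar_succ' {s : k} (hs : s ≠ 0) (a : ℤ) (m : ℕ) :
    descScalar s (a + 1) (m + 1)
      = s ^ (-(m : ℤ)) * (s ^ (a + 1) - s ^ (-a - 1)) * descScalar s a m := by
  rw [descScalar, descScalar, Finset.prod_range_succ', Nat.choose_succ_succ' m 1,
    Nat.choose_one_right, Nat.cast_add, neg_add, zpow_add₀ hs]
  have : ∀ l : ℕ, s ^ (a + 1 - ((l + 1 : ℕ) : ℤ)) - s ^ (((l + 1 : ℕ) : ℤ) - (a + 1))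
      = s ^ (a - l) - s ^ ((l : ℤ) - a) := fun l => by
    push_cast
    rw [add_sub_add_right_eq_sub, add_sub_add_right_eq_sub]
  simp only [this, Nat.cast_zero, sub_zero, zero_sub, neg_add']
  ring

/-- The coefficients of the comultiplication of the iterated braided commutators. -/
noncomputable def comulCoeff (s : k) (r n m : ℕ) : k :=
  qBinom s n m * descScalar s ((n : ℤ) - r) m

theorem comulCoeff_zero (s : k) (r n : ℕ) : comulCoeff s r n 0 = 1 := by
  simp [comulCoeff, qBinom_zero_right, descScalar]

/-- At `n = r` the product in `descScalar` contains the factor `s^0 - s^0`. -/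
theorem comulCoeff_self_succ {s : k} (hs : s ≠ 0) (r m : ℕ) : comulCoeff s r r (m + 1) = 0 := by
  have h := descScalar_succ' hs (-1) m
  simp only [neg_add_cancel, neg_neg, sub_self, zpow_zero, mul_zero, zero_mul] at h
  rw [comulCoeff, sub_self, h, mul_zero]

/-- The recursion imposed by `z_{n+1} = x z_n - s^{r-1-2n} z_n x`: the first power of `s` is the
cost of moving `x` across `g^{n-m} h`, the second is the scalar of the commutator. -/
theorem comulCoeff_succ_succ {s : k} (hs : s ≠ 0) (r n m : ℕ) :
    comulCoeff s r (n + 1) (m + 1) = comulCoeff s r n (m + 1)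
      + (s ^ (2 * ((n : ℤ) - m) + 1 - r) - s ^ ((r : ℤ) - 1 - 2 * n)) * comulCoeff s r n m := by
  have e : ((n + 1 : ℕ) : ℤ) - r = ((n : ℤ) - r) + 1 := by push_cast; ring
  have h1 := qBinom_succ_succ s n m
  have h2 := qBinom_succ_succ' hs n m
  rw [comulCoeff, comulCoeff, comulCoeff, e, descScalar_succ' hs, descScalar_succ hs]
  have e2 : s ^ (m + 1) = s ^ ((m : ℤ) + 1) := by rw [← zpow_natCast]; simp
  rw [e2] at h1
  -- The second Pascal recursion is used for the first power of `s` and the first recursion for the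
  -- other; the exponents then regroup as on the right.
  have h3 : qBinom s (n + 1) (m + 1) * (s ^ ((n : ℤ) - r + 1) - s ^ (-((n : ℤ) - r) - 1))
      = qBinom s n (m + 1) * (s ^ ((n : ℤ) - r - m) - s ^ ((m : ℤ) - (n - r)))
        + qBinom s n m * (s ^ (2 * (n : ℤ) - m + 1 - r) - s ^ ((r : ℤ) - 1 - 2 * n + m)) := by
    rw [mul_sub]
    nth_rw 1 [h2]
    rw [h1, add_mul, add_mul, mul_right_comm, mul_right_comm (s ^ ((n : ℤ) - m)),
      mul_right_comm (s ^ ((m : ℤ) + 1)), mul_right_comm (s ^ ((m : ℤ) - n))]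
    simp only [← zpow_add₀ hs]
    ring_nf
  have e3 : s ^ (2 * ((n : ℤ) - m) + 1 - r) = s ^ (-(m : ℤ)) * s ^ (2 * (n : ℤ) - m + 1 - r) := by
    rw [← zpow_add₀ hs]; ring_nf
  have e4 : s ^ ((r : ℤ) - 1 - 2 * n) = s ^ (-(m : ℤ)) * s ^ ((r : ℤ) - 1 - 2 * n + m) := by
    rw [← zpow_add₀ hs]; ring_nf
  rw [e3, e4]
  linear_combination s ^ (-(m : ℤ)) * descScalar s ((n : ℤ) - r) m * h3


/-- The comultiplication of an iterated braided commutator of two skew-primitive elements. -/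
theorem comul_iterComm {s : k} (hs : s ≠ 0) (r : ℕ) (Δ : A →ₐ[k] A ⊗[k] A) {x y g h : A}
    (hxg : x * g = s ^ (2 : ℤ) • (g * x)) (hxh : x * h = s ^ (1 - (r : ℤ)) • (h * x))
    (hyg : y * g = s ^ (1 - (r : ℤ)) • (g * y)) (hgh : h * g = g * h)
    (hx : Δ x = g ⊗ₜ x + x ⊗ₜ 1) (hy : Δ y = h ⊗ₜ y + y ⊗ₜ 1) (n : ℕ) :
    Δ (iterComm s r x y n) = iterComm s r x y n ⊗ₜ 1 + ∑ m ∈ Finset.range (n + 1),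
      comulCoeff s r n m • ((g ^ (n - m) * h * x ^ m) ⊗ₜ iterComm s r x y (n - m)) := by
  have hxgp (n : ℕ) : x * g ^ n = s ^ (2 * (n : ℤ)) • (g ^ n * x) := by
    induction n with
    | zero => simp
    | succ n ih =>
      rw [pow_succ, ← mul_assoc, ih, smul_mul_assoc, mul_assoc, hxg, mul_smul_comm, smul_smul,
        ← zpow_add₀ hs, mul_assoc]
      push_cast
      ring_nf
  have hxpg (n : ℕ) : x ^ n * g = s ^ (2 * (n : ℤ)) • (g * x ^ n) := by
    induction n with
    | zero => simp
    | succ n ih =>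
      rw [pow_succ, mul_assoc, hxg, mul_smul_comm, ← mul_assoc, ih, smul_mul_assoc, smul_smul,
        ← zpow_add₀ hs, mul_assoc]
      push_cast
      ring_nf
  have hzg (n : ℕ) : iterComm s r x y n * g
      = s ^ (2 * (n : ℤ) + 1 - r) • (g * iterComm s r x y n) := by
    induction n with
    | zero => simpa [iterComm] using hyg
    | succ n ih =>
      have e : s ^ (2 * ((n + 1 : ℕ) : ℤ) + 1 - r) = s ^ (2 * (n : ℤ) + 1 - r) * s ^ (2 : ℤ) := by
        rw [← zpow_add₀ hs]; push_cast; ring_nf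
      rw [e, iterComm, sub_mul, smul_mul_assoc, mul_assoc, ih, mul_assoc _ x g, hxg, mul_smul_comm,
        ← mul_assoc x, hxg, mul_smul_comm, ← mul_assoc _ g x, ih]
      simp only [mul_sub, smul_sub, smul_smul, smul_mul_assoc, mul_smul_comm, mul_assoc]
      ring_nf
  induction n with
  | zero => simp [iterComm, hy, comulCoeff_zero, add_comm]
  | succ n ih =>
    set c : k := s ^ ((r : ℤ) - 1 - 2 * n) with hc
    -- The scalar `c` is the inverse of the cost of moving `z_n` past `g`, so the terms `g z_n ⊗ x`
    -- cancel.
    have hz : Δ x * iterComm s r x y n ⊗ₜ 1 - c • (iterComm s r x y n ⊗ₜ 1 * Δ x)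
        = iterComm s r x y (n + 1) ⊗ₜ[k] (1 : A) := by
      have e : c * s ^ (2 * (n : ℤ) + 1 - r) = 1 := by
        rw [hc, ← zpow_add₀ hs]; ring_nf; simp
      rw [hx, add_mul, mul_add]
      simp only [Algebra.TensorProduct.tmul_mul_tmul, mul_one, one_mul]
      rw [hzg, ← TensorProduct.smul_tmul', smul_add, smul_smul, e, one_smul, iterComm, ← hc,
        TensorProduct.sub_tmul, TensorProduct.smul_tmul']
      abel
    -- Moving `x^m` past `g` multiplies `c` by `s^{2m}`, which gives the commutator scalar leading
    -- from `z_{n-m}` to `z_{n-m+1}`. The second summand collects the contributions of `x ⊗ 1` from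
    -- both sides.
    have hT (m : ℕ) (hm : m ≤ n) :
        Δ x * (g ^ (n - m) * h * x ^ m) ⊗ₜ iterComm s r x y (n - m)
          - c • ((g ^ (n - m) * h * x ^ m) ⊗ₜ iterComm s r x y (n - m) * Δ x)
        = (g ^ (n + 1 - m) * h * x ^ m) ⊗ₜ iterComm s r x y (n + 1 - m)
          + (s ^ (2 * ((n : ℤ) - m) + 1 - r) - c) •
            ((g ^ (n - m) * h * x ^ (m + 1)) ⊗ₜ[k] iterComm s r x y (n - m)) := by
      obtain ⟨d, rfl⟩ := Nat.exists_eq_add_of_le hm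
      have e : m + d + 1 - m = d + 1 := by omega
      rw [Nat.add_sub_cancel_left, e, iterComm, hx, add_mul, mul_add]
      simp only [Algebra.TensorProduct.tmul_mul_tmul, mul_one, one_mul]
      have h1 : g ^ d * h * x ^ m * g = s ^ (2 * (m : ℤ)) • (g ^ (d + 1) * h * x ^ m) := by
        rw [mul_assoc _ (x ^ m), hxpg, mul_smul_comm, ← mul_assoc, mul_assoc _ h, hgh, ← mul_assoc,
          pow_succ]
      have h2 : x * (g ^ d * h * x ^ m)
          = s ^ (2 * (d : ℤ) + 1 - r) • (g ^ d * h * x ^ (m + 1)) := by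
        have e : 2 * (d : ℤ) + 1 - r = 2 * (d : ℤ) + (1 - r) := by ring
        rw [e, zpow_add₀ hs, ← mul_assoc, ← mul_assoc, hxgp, smul_mul_assoc, smul_mul_assoc,
          mul_assoc _ x, hxh, mul_smul_comm, smul_mul_assoc, smul_smul, pow_succ']
        simp only [mul_assoc]
      have e1 : c * s ^ (2 * (m : ℤ)) = s ^ ((r : ℤ) - 1 - 2 * d) := by
        rw [hc, ← zpow_add₀ hs]; push_cast; ring_nf
      have e2 : 2 * (((m + d : ℕ) : ℤ) - m) + 1 - r = 2 * (d : ℤ) + 1 - r := by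
        push_cast; ring
      have h0 : g * (g ^ d * h * x ^ m) = g ^ (d + 1) * h * x ^ m := by
        rw [pow_succ']; simp only [mul_assoc]
      rw [h0, h1, h2, e2, mul_assoc _ (x ^ m) x, ← pow_succ, ← e1]
      simp only [TensorProduct.tmul_sub, ← TensorProduct.smul_tmul',
        TensorProduct.tmul_smul, smul_add, smul_smul, sub_smul]
      abel
    have hsum : Δ x * (∑ m ∈ Finset.range (n + 1),
          comulCoeff s r n m • ((g ^ (n - m) * h * x ^ m) ⊗ₜ[k] iterComm s r x y (n - m)))
        - c • ((∑ m ∈ Finset.range (n + 1),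
          comulCoeff s r n m • ((g ^ (n - m) * h * x ^ m) ⊗ₜ[k] iterComm s r x y (n - m))) * Δ x)
        = ∑ m ∈ Finset.range (n + 1 + 1), comulCoeff s r (n + 1) m •
          ((g ^ (n + 1 - m) * h * x ^ m) ⊗ₜ iterComm s r x y (n + 1 - m)) := by
      rw [Finset.mul_sum, Finset.sum_mul, Finset.smul_sum, ← Finset.sum_sub_distrib]
      have h1 : ∀ m ∈ Finset.range (n + 1),
          Δ x * (comulCoeff s r n m • ((g ^ (n - m) * h * x ^ m) ⊗ₜ[k] iterComm s r x y (n - m)))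
          - c • (comulCoeff s r n m • ((g ^ (n - m) * h * x ^ m) ⊗ₜ[k] iterComm s r x y (n - m))
            * Δ x)
          = comulCoeff s r n m •
              ((g ^ (n + 1 - m) * h * x ^ m) ⊗ₜ[k] iterComm s r x y (n + 1 - m))
            + (comulCoeff s r (n + 1) (m + 1) - comulCoeff s r n (m + 1)) •
              ((g ^ (n + 1 - (m + 1)) * h * x ^ (m + 1)) ⊗ₜ[k]
                iterComm s r x y (n + 1 - (m + 1))) := fun m hm => by
        rw [mul_smul_comm, smul_mul_assoc, smul_comm c, ← smul_sub,
          hT m (Nat.lt_succ_iff.1 (Finset.mem_range.1 hm)), comulCoeff_succ_succ hs,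
          add_sub_cancel_left, smul_add, smul_smul, Nat.succ_sub_succ, mul_comm]
      -- This lets the sum be extended by `m = n + 1`, so that the terms with `x^{m+1}` can be
      -- merged with it after an index shift.
      have h2 : comulCoeff s r n (n + 1) = 0 := by
        rw [comulCoeff, qBinom_eq_zero s n (n + 1) (by omega), zero_mul]
      have h3 : ∑ m ∈ Finset.range (n + 1), comulCoeff s r n m •
              ((g ^ (n + 1 - m) * h * x ^ m) ⊗ₜ[k] iterComm s r x y (n + 1 - m))
          = ∑ m ∈ Finset.range (n + 1 + 1), comulCoeff s r n m •
              ((g ^ (n + 1 - m) * h * x ^ m) ⊗ₜ[k] iterComm s r x y (n + 1 - m)) := by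
        rw [Finset.sum_range_succ _ (n + 1), h2, zero_smul, add_zero]
      rw [Finset.sum_congr rfl h1, Finset.sum_add_distrib, h3, Finset.sum_range_succ' _ (n + 1),
        Finset.sum_range_succ' _ (n + 1), add_right_comm, ← Finset.sum_add_distrib,
        comulCoeff_zero, comulCoeff_zero]
      simp only [← add_smul, add_sub_cancel]
    rw [← hz, ← hsum, iterComm, map_sub, map_smul, map_mul, map_mul, ih]
    simp only [mul_add, add_mul, smul_add]
    abel

/-- The quantum Serre element of two skew-primitive elements is skew-primitive. -/
theorem comul_qSerre {s : k} (hs : s ≠ 0) (r : ℕ) (Δ : A →ₐ[k] A ⊗[k] A) {x y g h : A}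
    (hxg : x * g = s ^ (2 : ℤ) • (g * x)) (hxh : x * h = s ^ (1 - (r : ℤ)) • (h * x))
    (hyg : y * g = s ^ (1 - (r : ℤ)) • (g * y)) (hgh : h * g = g * h)
    (hx : Δ x = g ⊗ₜ x + x ⊗ₜ 1) (hy : Δ y = h ⊗ₜ y + y ⊗ₜ 1) :
    Δ (qSerre s r x y) = (g ^ r * h) ⊗ₜ qSerre s r x y + qSerre s r x y ⊗ₜ 1 := by
  rw [← iterComm_self hs, comul_iterComm hs r Δ hxg hxh hyg hgh hx hy, add_comm,
    Finset.sum_range_succ']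
  simp [comulCoeff_self_succ hs, comulCoeff_zero]

end SkewPrimitive

/-! ### Hopf structures along algebra isomorphisms. -/

section HopfTransport

variable {k A B : Type*} [CommRing k] [Ring A] [HopfAlgebra k A] [Ring B] [Algebra k B]

open Bialgebra HopfAlgebra

/-- Transport of a Hopf algebra structure along an isomorphism of algebras. -/
noncomputable def HopfStructure.ofAlgEquiv (e : A ≃ₐ[k] B) : HopfStructure k B where
  comul := ((Algebra.TensorProduct.map e.toAlgHom e.toAlgHom).comp (comulAlgHom k A)).comp
    e.symm.toAlgHom
  counit := (counitAlgHom k A).comp e.symm.toAlgHom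
  antipode := e.toLinearMap ∘ₗ HopfAlgebra.antipode k ∘ₗ e.symm.toLinearMap
  coassoc := by
    have h1 (y : A) (u : A ⊗[k] A) : Algebra.TensorProduct.assoc k k k B B B
          (Algebra.TensorProduct.map e.toAlgHom e.toAlgHom u ⊗ₜ e y)
        = Algebra.TensorProduct.map e.toAlgHom (Algebra.TensorProduct.map e.toAlgHom e.toAlgHom)
          (Algebra.TensorProduct.assoc k k k A A A (u ⊗ₜ y)) := by
      induction u with
      | zero => simp
      | add x y hx hy => simp only [map_add, TensorProduct.add_tmul, hx, hy]
      | tmul x y => simp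
    have h2 (t : A ⊗[k] A) : Algebra.TensorProduct.assoc k k k B B B
          (Algebra.TensorProduct.map (((Algebra.TensorProduct.map e.toAlgHom e.toAlgHom).comp
            (comulAlgHom k A)).comp e.symm.toAlgHom) (.id k B)
            (Algebra.TensorProduct.map e.toAlgHom e.toAlgHom t))
        = Algebra.TensorProduct.map e.toAlgHom (Algebra.TensorProduct.map e.toAlgHom e.toAlgHom)
          (Algebra.TensorProduct.assoc k k k A A A
            (Algebra.TensorProduct.map (comulAlgHom k A) (.id k A) t)) := by
      induction t with
      | zero => simp
      | add x y hx hy => simp only [map_add, hx, hy]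
      | tmul x y => simpa using h1 y _
    have h3 (t : A ⊗[k] A) : Algebra.TensorProduct.map (.id k B)
          (((Algebra.TensorProduct.map e.toAlgHom e.toAlgHom).comp
            (comulAlgHom k A)).comp e.symm.toAlgHom)
            (Algebra.TensorProduct.map e.toAlgHom e.toAlgHom t)
        = Algebra.TensorProduct.map e.toAlgHom (Algebra.TensorProduct.map e.toAlgHom e.toAlgHom)
            (Algebra.TensorProduct.map (.id k A) (comulAlgHom k A) t) := by
      induction t with
      | zero => simp
      | add x y hx hy => simp only [map_add, hx, hy]
      | tmul x y => simp
    have h4 (a : A) : Algebra.TensorProduct.assoc k k k A A A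
          (Algebra.TensorProduct.map (comulAlgHom k A) (.id k A) (Coalgebra.comul a))
        = Algebra.TensorProduct.map (.id k A) (comulAlgHom k A) (Coalgebra.comul a) :=
      Coalgebra.coassoc_apply (R := k) a
    refine AlgHom.ext fun b => ?_
    obtain ⟨a, rfl⟩ := e.surjective b
    have := (h2 (Coalgebra.comul a)).trans ((congrArg _ (h4 a)).trans (h3 _).symm)
    simpa using this
  rTensor_counit := by
    have h (t : A ⊗[k] A) : Algebra.TensorProduct.map ((counitAlgHom k A).comp e.symm.toAlgHom)
          (.id k B) (Algebra.TensorProduct.map e.toAlgHom e.toAlgHom t)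
        = Algebra.TensorProduct.map (.id k k) e.toAlgHom
          (Algebra.TensorProduct.map (counitAlgHom k A) (.id k A) t) := by
      induction t with
      | zero => simp
      | add x y hx hy => simp only [map_add, hx, hy]
      | tmul x y => simp
    have h' (a : A) : Algebra.TensorProduct.map (counitAlgHom k A) (.id k A) (Coalgebra.comul a)
        = 1 ⊗ₜ a := Coalgebra.rTensor_counit_comul (R := k) a
    refine AlgHom.ext fun b => ?_
    obtain ⟨a, rfl⟩ := e.surjective b
    have := (h (Coalgebra.comul a)).trans (congrArg _ (h' a))
    simpa using this
  lTensor_counit := by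
    have h (t : A ⊗[k] A) : Algebra.TensorProduct.map (.id k B)
          ((counitAlgHom k A).comp e.symm.toAlgHom)
          (Algebra.TensorProduct.map e.toAlgHom e.toAlgHom t)
        = Algebra.TensorProduct.map e.toAlgHom (.id k k)
          (Algebra.TensorProduct.map (.id k A) (counitAlgHom k A) t) := by
      induction t with
      | zero => simp
      | add x y hx hy => simp only [map_add, hx, hy]
      | tmul x y => simp
    have h' (a : A) : Algebra.TensorProduct.map (.id k A) (counitAlgHom k A) (Coalgebra.comul a)
        = a ⊗ₜ 1 := Coalgebra.lTensor_counit_comul (R := k) a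
    refine AlgHom.ext fun b => ?_
    obtain ⟨a, rfl⟩ := e.surjective b
    have := (h (Coalgebra.comul a)).trans (congrArg _ (h' a))
    simpa using this
  antipode_left b := by
    have h (t : A ⊗[k] A) : LinearMap.mul' k B ((e.toLinearMap ∘ₗ HopfAlgebra.antipode k ∘ₗ
          e.symm.toLinearMap).rTensor B (Algebra.TensorProduct.map e.toAlgHom e.toAlgHom t))
        = e (LinearMap.mul' k A ((HopfAlgebra.antipode k).rTensor A t)) := by
      induction t with
      | zero => simp
      | add x y hx hy => simp only [map_add, hx, hy]
      | tmul x y => simp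
    obtain ⟨a, rfl⟩ := e.surjective b
    have := (h (Coalgebra.comul a)).trans
      (congrArg e (HopfAlgebra.mul_antipode_rTensor_comul_apply (R := k) a))
    simpa using this
  antipode_right b := by
    have h (t : A ⊗[k] A) : LinearMap.mul' k B ((e.toLinearMap ∘ₗ HopfAlgebra.antipode k ∘ₗ
          e.symm.toLinearMap).lTensor B (Algebra.TensorProduct.map e.toAlgHom e.toAlgHom t))
        = e (LinearMap.mul' k A ((HopfAlgebra.antipode k).lTensor A t)) := by
      induction t with
      | zero => simp
      | add x y hx hy => simp only [map_add, hx, hy]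
      | tmul x y => simp
    obtain ⟨a, rfl⟩ := e.surjective b
    have := (h (Coalgebra.comul a)).trans
      (congrArg e (HopfAlgebra.mul_antipode_lTensor_comul_apply (R := k) a))
    simpa using this

theorem HopfStructure.ofAlgEquiv_comul (e : A ≃ₐ[k] B) (a : A) :
    (HopfStructure.ofAlgEquiv e).comul (e a)
      = Algebra.TensorProduct.map e.toAlgHom e.toAlgHom (Coalgebra.comul (R := k) a) := by
  simp [HopfStructure.ofAlgEquiv]

theorem HopfStructure.ofAlgEquiv_counit (e : A ≃ₐ[k] B) (a : A) :
    (HopfStructure.ofAlgEquiv e).counit (e a) = Coalgebra.counit (R := k) a := by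
  simp [HopfStructure.ofAlgEquiv]

theorem HopfStructure.ofAlgEquiv_antipode (e : A ≃ₐ[k] B) (a : A) :
    (HopfStructure.ofAlgEquiv e).antipode (e a) = e (HopfAlgebra.antipode k a) := by
  simp [HopfStructure.ofAlgEquiv]

theorem HopfStructure.nonempty_bialgEquiv_ofAlgEquiv (e : A ≃ₐ[k] B) :
    letI := (HopfStructure.ofAlgEquiv e).toHopfAlgebra
    Nonempty (A ≃ₐc[k] B) := by
  let _ := (HopfStructure.ofAlgEquiv e).toHopfAlgebra
  exact ⟨BialgEquiv.ofAlgEquiv e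
    (AlgHom.ext fun a => HopfStructure.ofAlgEquiv_counit e a)
    (AlgHom.ext fun a => (HopfStructure.ofAlgEquiv_comul e a).symm)⟩

end HopfTransport

/-! ### Hopf ideals generated by skew-primitive elements. -/

theorem map_eq_zero_of_mem_span {k A B : Type*} [CommRing k] [Ring A] [Algebra k A] [Ring B]
    [Algebra k B] (F : A →ₐ[k] B) {S : Set A} (hF : ∀ x ∈ S, F x = 0) {x : A}
    (hx : x ∈ TwoSidedIdeal.span S) : F x = 0 := by
  have : TwoSidedIdeal.span S ≤ TwoSidedIdeal.ker F :=
    TwoSidedIdeal.span_le.2 fun x hx => (TwoSidedIdeal.mem_ker _).2 (hF x hx)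
  exact (TwoSidedIdeal.mem_ker _).1 (this hx)

section HopfIdeal

variable {k A : Type*} [CommRing k] [Ring A] [HopfAlgebra k A]

open Bialgebra HopfAlgebra

/-- A two-sided ideal generated by skew-primitive elements on which the counit vanishes is a Hopf
ideal. -/
theorem isHopfIdeal_span_of_skewPrimitive (S : Set A)
    (hS : ∀ x ∈ S, Coalgebra.counit (R := k) x = 0 ∧
      ∃ a : A, Coalgebra.comul (R := k) x = a ⊗ₜ[k] x + x ⊗ₜ[k] 1) :
    (TwoSidedIdeal.span S).asIdeal.IsHopfIdeal k := by
  set I := (TwoSidedIdeal.span S).asIdeal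
  have : I.IsTwoSided := inferInstanceAs (TwoSidedIdeal.asIdeal _).IsTwoSided
  have hmem : ∀ x ∈ S, x ∈ I := fun x hx => TwoSidedIdeal.subset_span hx
  refine { counit_eq_zero := ?_, map_mkQ_comul_eq_zero := ?_, antipode_mem := ?_ }
  · exact fun x hx => map_eq_zero_of_mem_span (Bialgebra.counitAlgHom k A) (fun x hx => (hS x hx).1) hx
  · intro x hx
    refine map_eq_zero_of_mem_span
      ((Algebra.TensorProduct.map (Ideal.Quotient.mkₐ k I) (Ideal.Quotient.mkₐ k I)).comp
      (comulAlgHom k A)) (fun x hx => ?_) hx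
    obtain ⟨-, a, h⟩ := hS x hx
    have hx0 : Ideal.Quotient.mkₐ k I x = 0 := Ideal.Quotient.eq_zero_iff_mem.2 (hmem x hx)
    simp only [AlgHom.comp_apply, comulAlgHom_apply, h, map_add, Algebra.TensorProduct.map_tmul,
      hx0, TensorProduct.tmul_zero, TensorProduct.zero_tmul, add_zero]
  · intro x hx
    induction hx using TwoSidedIdeal.span_induction with
    | mem x hx =>
      obtain ⟨h0, a, h⟩ := hS x hx
      -- The antipode axiom reads `S(a) x + S(x) = ε(x) = 0`, hence `S(x) = -S(a) x` lies in the
      -- ideal.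
      have := mul_antipode_rTensor_comul_apply (R := k) x
      rw [h, h0, map_add, LinearMap.rTensor_tmul, LinearMap.rTensor_tmul, map_add,
        LinearMap.mul'_apply, LinearMap.mul'_apply, mul_one, map_zero, add_comm] at this
      rw [eq_neg_of_add_eq_zero_left this]
      exact I.neg_mem (I.mul_mem_left _ (hmem x hx))
    | zero => simp
    | add x y _ _ hx hy => rw [map_add]; exact I.add_mem hx hy
    | neg x _ hx => rw [map_neg]; exact I.neg_mem hx
    | left_absorb a x _ hx =>
      rw [antipode_mul_antidistrib]; exact I.mul_mem_right _ hx
    | right_absorb b x _ hx =>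
      rw [antipode_mul_antidistrib]; exact I.mul_mem_left _ hx

end HopfIdeal

/-! ### Twisting Serre elements by scalar-commuting factors, and braided commutators. -/

section QuantumSerre

variable {k A : Type*} [Field k] [Ring A] [Algebra k A]

theorem map_qSerre {B : Type*} [Ring B] [Algebra k B] (f : A →ₐ[k] B) (q : k) (r : ℕ) (x y : A) :
    f (qSerre q r x y) = qSerre q r (f x) (f y) := by
  simp only [qSerre, map_sum, map_smul, map_mul, map_pow]

/-- Each pair of factors `x a` contributes one `α`. Each `x a` also contributes one `β`, whether it
stands before `y b` (moving `a` past `y`) or after it (moving `b` past `x`). Hence the scalar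
depends on `p + m` only and is common to all terms of a Serre element. -/
theorem pow_mul_mul_pow_twist {α β : k} {x y a b : A} (hax : a * x = α • (x * a))
    (hay : a * y = β • (y * a)) (hbx : b * x = β • (x * b)) (hab : a * b = b * a) (p m : ℕ) :
    (x * a) ^ p * (y * b) * (x * a) ^ m
      = (∏ l ∈ Finset.range (p + m), (α ^ l * β)) • (x ^ p * y * x ^ m * (a ^ (p + m) * b)) := by
  have haxp (n : ℕ) : a * x ^ n = α ^ n • (x ^ n * a) := by
    induction n with
    | zero => simp
    | succ n ih =>
      rw [pow_succ, ← mul_assoc, ih, smul_mul_assoc, mul_assoc, hax, mul_smul_comm, smul_smul,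
        mul_assoc, pow_succ]
  have hapx (n : ℕ) : a ^ n * x = α ^ n • (x * a ^ n) := by
    induction n with
    | zero => simp
    | succ n ih =>
      rw [pow_succ, mul_assoc, hax, mul_smul_comm, ← mul_assoc, ih, smul_mul_assoc, smul_smul,
        mul_assoc, pow_succ, mul_comm]
  induction p with
  | zero =>
    induction m with
    | zero => simp
    | succ m ih =>
      simp only [pow_zero, one_mul, zero_add] at ih ⊢
      rw [pow_succ (x * a), ← mul_assoc, ih, Finset.prod_range_succ, smul_mul_assoc, mul_smul]
      congr 1
      calc y * x ^ m * (a ^ m * b) * (x * a) = y * x ^ m * (a ^ m * (b * x) * a) := by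
            simp only [mul_assoc]
        _ = (α ^ m * β) • (y * x ^ m * (x * a ^ m * b * a)) := by
            rw [hbx, mul_smul_comm, ← mul_assoc (a ^ m), hapx]
            simp only [smul_mul_assoc, mul_smul_comm, smul_smul, mul_comm β]
        _ = _ := by
            rw [mul_assoc _ b a, ← hab, pow_succ, pow_succ]
            simp only [mul_assoc]
  | succ p ih =>
    rw [pow_succ', mul_assoc, mul_assoc, ← mul_assoc (_ ^ p), ih, mul_smul_comm,
      Nat.add_right_comm p 1 m, Finset.prod_range_succ, mul_smul]
    congr 1
    calc x * a * (x ^ p * y * x ^ m * (a ^ (p + m) * b))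
        = x * (a * x ^ p * y * x ^ m * (a ^ (p + m) * b)) := by simp only [mul_assoc]
      _ = (α ^ (p + m) * β) • (x * (x ^ p * y * (x ^ m * a) * (a ^ (p + m) * b))) := by
          rw [haxp, smul_mul_assoc, mul_assoc _ a y, hay, mul_smul_comm, smul_smul, smul_mul_assoc,
            ← mul_assoc _ y a, mul_assoc _ a, haxp, mul_smul_comm, smul_smul, smul_mul_assoc,
            mul_smul_comm, pow_add]
          ring_nf
      _ = _ := by
          rw [pow_succ' x, pow_succ' a]
          simp only [mul_assoc]

/-- Rescaling the arguments of a quantum Serre element by elements which commute with them up to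
scalars. -/
theorem qSerre_mul_twist {α β : k} {x y a b : A} (hax : a * x = α • (x * a))
    (hay : a * y = β • (y * a)) (hbx : b * x = β • (x * b)) (hab : a * b = b * a) (q : k) (r : ℕ) :
    qSerre q r (x * a) (y * b)
      = (∏ l ∈ Finset.range r, (α ^ l * β)) • (qSerre q r x y * (a ^ r * b)) := by
  rw [qSerre, qSerre, Finset.sum_mul, Finset.smul_sum]
  refine Finset.sum_congr rfl fun m hm => ?_
  rw [pow_mul_mul_pow_twist hax hay hbx hab, smul_comm, smul_mul_assoc,
    Nat.sub_add_cancel (Nat.lt_succ_iff.1 (Finset.mem_range.1 hm))]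

/-- The braided commutator of two skew-primitive elements is skew-primitive when the braidings
cancel. -/
theorem comul_braidedComm (Δ : A →ₐ[k] A ⊗[k] A) {x y g h : A} {a b c d : k}
    (hxh : x * h = c • (h * x)) (hyg : y * g = d • (g * y)) (hgh : h * g = g * h)
    (had : b * d = a) (hac : a * c = b)
    (hx : Δ x = g ⊗ₜ x + x ⊗ₜ 1) (hy : Δ y = h ⊗ₜ y + y ⊗ₜ 1) :
    Δ (a • (x * y) - b • (y * x)) = (g * h) ⊗ₜ (a • (x * y) - b • (y * x))
      + (a • (x * y) - b • (y * x)) ⊗ₜ 1 := by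
  simp only [map_sub, map_smul, map_mul, hx, hy, mul_add, add_mul,
    Algebra.TensorProduct.tmul_mul_tmul, mul_one, one_mul, hxh, hyg, hgh,
    TensorProduct.tmul_sub, TensorProduct.sub_tmul, TensorProduct.tmul_smul,
    ← TensorProduct.smul_tmul', smul_add, smul_smul, had, hac]
  abel

end QuantumSerre

/-! ### Commutation, coproduct and antipode of the elements `E_j`. -/

namespace ESC

variable {k G J : Type*} [Field k] [Group G] (E : ESC k G J)

theorem gen_mul_grp (j : J) (h : G) :
    E.gen j * E.grp h = (E.χ j h : k) • (E.grp h * E.gen j) := by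
  rw [gen, arr_mul_grp, grp_mul_arr]
  simp [Arrow.left, Arrow.right]

theorem comulHom_gen (j : J) :
    E.comulHom (E.gen j) = E.grp (E.g j) ⊗ₜ E.gen j + E.gen j ⊗ₜ 1 := by
  rw [gen, comulHom_arr]
  simp [Arrow.tgt]

theorem counitHom_gen (j : J) : E.counitHom (E.gen j) = 0 := E.counitHom_arr _

theorem antipodeMap_gen (j : J) :
    E.antipodeMap (E.gen j) = -(E.grp (E.g j)⁻¹ * E.gen j) := by
  rw [gen, antipodeMap_arr]
  simp [Arrow.tgt]

theorem arr_eq (a : E.Arrow) : E.arr a = E.grp a.src * E.gen a.idx := by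
  rw [gen, grp_mul_arr]
  simp [Arrow.left]

end ESC

/-! ### The free abelian group `G` and square roots of the `g_j`. -/

namespace LocalFLFree

variable {k G J N : Type*} [Field k] [Group G] {E : ESC k G J} (D : LocalFLFree E N)

theorem mem_J₁ {u : N} {i : J} (hi : i ∈ D.P u) : i ∈ D.J₁ := Set.mem_iUnion.2 ⟨u, hi⟩

theorem not_mem_J₁ {u : N} {j : J} (hj : j ∈ D.P' u) : j ∉ D.J₁ := fun h => by
  obtain ⟨v, hv⟩ := Set.mem_iUnion.1 h
  exact Set.disjoint_left.1 (D.disjoint_P_P' v u) hv hj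

theorem exists_σ_eq {u : N} {j : J} (hj : j ∈ D.P' u) : ∃ i ∈ D.P u, D.σ i = j :=
  (D.σ_bijOn u).surjOn hj

theorem σ_mem {u : N} {i : J} (hi : i ∈ D.P u) : D.σ i ∈ D.P' u := (D.σ_bijOn u).mapsTo hi

include D in
theorem group_comm (x y : G) : x * y = y * x := by
  obtain ⟨e, -⟩ := D.free
  exact e.injective (by rw [map_mul, map_mul, mul_comm])

theorem group_induction {p : G → Prop} (one : p 1) (gen : ∀ i ∈ D.J₁, p (D.ξ i))
    (inv : ∀ x, p x → p x⁻¹) (mul : ∀ x y, p x → p y → p (x * y)) (x : G) : p x := by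
  obtain ⟨e, he⟩ := D.free
  have he' (i : (⋃ u, D.P u : Set J)) :
      e.symm (Multiplicative.ofAdd (FreeAbelianGroup.of i)) = D.ξ i := by
    rw [← he, e.symm_apply_apply]
  have h (t : FreeAbelianGroup (⋃ u, D.P u : Set J)) : p (e.symm (Multiplicative.ofAdd t)) := by
    induction t using FreeAbelianGroup.induction_on with
    | zero => rw [ofAdd_zero, map_one]; exact one
    | of i => rw [he']; exact gen i i.2
    | neg i hi => rw [ofAdd_neg, map_inv]; exact inv _ hi
    | add s t hs ht => rw [ofAdd_add, map_mul]; exact mul _ _ hs ht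
  have := h (e x).toAdd
  rwa [ofAdd_toAdd, e.symm_apply_apply] at this

/-- The universal property of `G`, for families of commuting units. -/
theorem exists_groupHom {M : Type*} [Monoid M] (f f' : J → M) (hf : ∀ i ∈ D.J₁, f i * f' i = 1)
    (hf' : ∀ i ∈ D.J₁, f' i * f i = 1) (hcomm : ∀ i ∈ D.J₁, ∀ j ∈ D.J₁, f i * f j = f j * f i) :
    ∃ φ : G →* M, ∀ i ∈ D.J₁, φ (D.ξ i) = f i := by
  obtain ⟨e, he⟩ := D.free
  let F (i : (⋃ u, D.P u : Set J)) : Mˣ := ⟨f i, f' i, hf i i.2, hf' i i.2⟩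
  have hF : ∀ x ∈ Set.range F, ∀ y ∈ Set.range F, x * y = y * x := by
    rintro _ ⟨i, rfl⟩ _ ⟨j, rfl⟩
    exact Units.ext (hcomm i i.2 j j.2)
  let H := Subgroup.closure (Set.range F)
  -- The universal property of the free abelian group needs a commutative target; the subgroup of
  -- units generated by the commuting family provides one.
  let _ : CommGroup H := { (inferInstance : Group H) with
    mul_comm := (Subgroup.isMulCommutative_closure hF).is_comm.comm }
  let L : Multiplicative (FreeAbelianGroup (⋃ u, D.P u : Set J)) →* H :=
    AddMonoidHom.toMultiplicativeLeft (FreeAbelianGroup.lift fun i =>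
      Additive.ofMul (⟨F i, Subgroup.subset_closure ⟨i, rfl⟩⟩ : H))
  refine ⟨(Units.coeHom M).comp (H.subtype.comp (L.comp e.toMonoidHom)), fun i hi => ?_⟩
  have h1 : e (D.ξ i) = _ := he ⟨i, hi⟩
  have h2 : L (Multiplicative.ofAdd (FreeAbelianGroup.of ⟨i, hi⟩))
      = ⟨F ⟨i, hi⟩, Subgroup.subset_closure ⟨_, rfl⟩⟩ :=
    congrArg Additive.toMul (FreeAbelianGroup.lift_apply_of _ _)
  simp [h1, h2, F]

open Classical in
/-- The element `ξ_i` of `G` for `i ∈ J^(1)`, and `ξ_i⁻¹` otherwise; a square root of `g_i`. -/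
noncomputable def rt (j : J) : G := if j ∈ D.J₁ then D.ξ j else (D.ξ j)⁻¹

theorem rt_eq {i : J} (hi : i ∈ D.J₁) : D.rt i = D.ξ i := if_pos hi

theorem rt_eq_inv {u : N} {j : J} (hj : j ∈ D.P' u) : D.rt j = (D.ξ j)⁻¹ :=
  if_neg (D.not_mem_J₁ hj)

theorem rt_σ {u : N} {i : J} (hi : i ∈ D.P u) : D.rt (D.σ i) = D.ξ i := by
  rw [D.rt_eq_inv (D.σ_mem hi), D.ξ_σ u i hi, inv_inv]

theorem g_eq_rt (j : J) : E.g j = D.rt j ^ 2 := by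
  obtain ⟨u, hj | hj⟩ := D.cover j
  · rw [D.rt_eq (D.mem_J₁ hj), D.g_eq u j hj]
  · obtain ⟨i, hi, rfl⟩ := D.exists_σ_eq hj
    rw [D.rt_σ hi, D.g_σ u i hi]

theorem χ_rt_comm {u : N} {i j : J} (h : (i ∈ D.P u ∧ j ∈ D.P u) ∨ (i ∈ D.P' u ∧ j ∈ D.P' u)) :
    E.χ i (D.rt j) = E.χ j (D.rt i) := by
  have key {i j : J} (hi : i ∈ D.P u) (hj : j ∈ D.P u) : E.χ i (D.ξ j) = E.χ j (D.ξ i) := by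
    by_cases hij : i = j
    · rw [hij]
    · exact D.χ_ξ_symm u i hi j hj hij
  obtain ⟨hi, hj⟩ | ⟨hi, hj⟩ := h
  · rw [D.rt_eq (D.mem_J₁ hi), D.rt_eq (D.mem_J₁ hj), key hi hj]
  · obtain ⟨i, hi', rfl⟩ := D.exists_σ_eq hi
    obtain ⟨j, hj', rfl⟩ := D.exists_σ_eq hj
    rw [D.rt_σ hi', D.rt_σ hj', D.χ_σ u i hi' j hj', D.χ_σ u j hj' i hi', key hi' hj']

/-- Passing from an index to its image under `σ` keeps `rt` but inverts the character on the `ξ_i`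
of the same block, so the symmetry `χ_rt_comm` becomes an inverse relation across `J_u` and `J_u'`.
-/
theorem χ_rt_mul {u : N} {i j : J} (hi : i ∈ D.P u) (hj : j ∈ D.P' u) :
    E.χ i (D.rt j) * E.χ j (D.rt i) = 1 := by
  obtain ⟨j, hj', rfl⟩ := D.exists_σ_eq hj
  have := D.χ_rt_comm (.inl ⟨hi, hj'⟩)
  rw [D.rt_eq (D.mem_J₁ hi), D.rt_eq (D.mem_J₁ hj')] at this
  rw [D.rt_σ hj', D.rt_eq (D.mem_J₁ hi), D.χ_σ u j hj' i hi, this, mul_inv_cancel]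

/-- This is `χ_ξ_pow` solved for `χ_j(g_i)`. On the primed side both characters are inverted and `r`
is unchanged. -/
theorem χ_rt_sq {u : N} {i j : J} (h : (i ∈ D.P u ∧ j ∈ D.P u) ∨ (i ∈ D.P' u ∧ j ∈ D.P' u))
    (hij : i ≠ j) : E.χ j (D.rt i) ^ 2 = E.χ i (D.rt i) ^ (1 - (D.r i j : ℤ)) := by
  have key {i j : J} (hi : i ∈ D.P u) (hj : j ∈ D.P u) (hij : i ≠ j) :
      E.χ j (D.ξ i) ^ 2 = E.χ i (D.ξ i) ^ (1 - (D.r i j : ℤ)) := by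
    have h := D.χ_ξ_pow u i hi j hj hij
    have hr := D.r_pos i (D.mem_J₁ hi) j (D.mem_J₁ hj) hij
    rw [D.g_eq u i hi, map_pow] at h
    rw [eq_inv_of_mul_eq_one_right h, ← zpow_natCast, ← zpow_neg, Nat.cast_sub hr, neg_sub,
      Nat.cast_one]
  obtain ⟨hi, hj⟩ | ⟨hi, hj⟩ := h
  · rw [D.rt_eq (D.mem_J₁ hi), key hi hj hij]
  · obtain ⟨i, hi', rfl⟩ := D.exists_σ_eq hi
    obtain ⟨j, hj', rfl⟩ := D.exists_σ_eq hj
    have hij' : i ≠ j := fun h => hij (by rw [h])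
    rw [D.rt_σ hi', D.χ_σ u j hj' i hi', D.χ_σ u i hi' i hi',
      D.r_σ i (D.mem_J₁ hi') j (D.mem_J₁ hj') hij', inv_pow, key hi' hj' hij', inv_zpow]

/-- The parameter in the relations is `χ_i(rt i)⁻¹` on `J_u` and `χ_i(rt i)` on `J_u'`; the
invariance under `q ↦ q⁻¹` removes the distinction. -/
theorem qSerre_χ_ξ {A : Type*} [Ring A] [Algebra k A] (i : J) (r : ℕ) (x y : A) :
    qSerre (E.χ i (D.ξ i)⁻¹ : k) r x y = qSerre (E.χ i (D.rt i) : k) r x y := by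
  obtain ⟨u, hi | hi⟩ := D.cover i
  · rw [D.rt_eq (D.mem_J₁ hi), map_inv, Units.val_inv_eq_inv_val, qSerre_inv (Units.ne_zero _)]
  · rw [D.rt_eq_inv hi]

/-! ### The ideal is a Hopf ideal -/

theorem gen_mul_grp_g {u : N} {i j : J}
    (h : (i ∈ D.P u ∧ j ∈ D.P u) ∨ (i ∈ D.P' u ∧ j ∈ D.P' u)) (hij : i ≠ j) :
    E.gen j * E.grp (E.g i)
      = (E.χ i (D.rt i) : k) ^ (1 - (D.r i j : ℤ)) • (E.grp (E.g i) * E.gen j) := by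
  rw [E.gen_mul_grp, D.g_eq_rt, map_pow, D.χ_rt_sq h hij, Units.val_zpow_eq_zpow_val]

theorem comulHom_qSerre {u : N} {i j : J}
    (h : (i ∈ D.P u ∧ j ∈ D.P u) ∨ (i ∈ D.P' u ∧ j ∈ D.P' u)) (hij : i ≠ j) :
    E.comulHom (qSerre (E.χ i (D.rt i) : k) (D.r i j) (E.gen i) (E.gen j))
      = (E.grp (E.g i) ^ D.r i j * E.grp (E.g j)) ⊗ₜ
          qSerre (E.χ i (D.rt i) : k) (D.r i j) (E.gen i) (E.gen j)
        + qSerre (E.χ i (D.rt i) : k) (D.r i j) (E.gen i) (E.gen j) ⊗ₜ 1 := by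
  refine comul_qSerre (Units.ne_zero _) _ _ ?_ ?_ (D.gen_mul_grp_g h hij) ?_
    (E.comulHom_gen i) (E.comulHom_gen j)
  · rw [E.gen_mul_grp, D.g_eq_rt, map_pow, Units.val_pow_eq_pow_val]
    norm_cast
  · rw [E.gen_mul_grp, D.g_eq_rt j, map_pow, D.χ_rt_comm h, D.χ_rt_sq h hij,
      Units.val_zpow_eq_zpow_val]
  · rw [← map_mul, ← map_mul, D.group_comm]

theorem comulHom_commElt {u : N} {i j : J} (hi : i ∈ D.P u) (hj : j ∈ D.P' u) :
    E.comulHom (D.commElt i j) = (E.grp (E.g i) * E.grp (E.g j)) ⊗ₜ D.commElt i j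
      + D.commElt i j ⊗ₜ 1 := by
  have hχ := congrArg (Units.val (α := k)) (D.χ_rt_mul hi hj)
  rw [D.rt_eq (D.mem_J₁ hi), D.rt_eq_inv hj, map_inv, Units.val_mul, Units.val_one,
    Units.val_inv_eq_inv_val] at hχ
  have hχj : (E.χ j (E.g i) : k) = (E.χ j (D.ξ i) : k) ^ 2 := by
    rw [D.g_eq_rt, D.rt_eq (D.mem_J₁ hi), map_pow, Units.val_pow_eq_pow_val]
  have hχi : (E.χ i (E.g j) : k) = (E.χ i (D.ξ j) : k)⁻¹ ^ 2 := by
    rw [D.g_eq_rt, D.rt_eq_inv hj, map_pow, Units.val_pow_eq_pow_val, map_inv,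
      Units.val_inv_eq_inv_val]
  have h1 := comul_braidedComm E.comulHom (a := (E.χ j (D.ξ i) : k)) (b := (E.χ i (D.ξ j) : k)⁻¹)
    (E.gen_mul_grp i (E.g j)) (E.gen_mul_grp j (E.g i))
    (by rw [← map_mul, ← map_mul, D.group_comm])
    (by rw [hχj]; linear_combination (E.χ j (D.ξ i) : k) * hχ)
    (by rw [hχi]; linear_combination (E.χ i (D.ξ j) : k)⁻¹ * hχ)
    (E.comulHom_gen i) (E.comulHom_gen j)
  rw [commElt, map_sub, h1, TensorProduct.tmul_sub, TensorProduct.sub_tmul]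
  split_ifs with hσ
  -- Since `g_j = g_i`, the element `g_i² - 1` is skew-primitive for the same group-like `g_i g_j`
  -- as the braided commutator.
  · have hg : E.g j = E.g i := by rw [← hσ, D.g_eq u i hi, D.g_σ u i hi]
    rw [map_smul, map_sub, map_pow, E.comulHom_grp, Algebra.TensorProduct.tmul_pow, map_one]
    simp only [hg, Algebra.TensorProduct.one_def, TensorProduct.tmul_sub,
      TensorProduct.sub_tmul, TensorProduct.tmul_smul, ← TensorProduct.smul_tmul', smul_sub, sq]
    abel
  · rw [map_zero, sub_zero, sub_zero, TensorProduct.tmul_sub, TensorProduct.sub_tmul]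

theorem isHopfIdeal_I : D.I.IsHopfIdeal k := by
  refine isHopfIdeal_span_of_skewPrimitive _ ?_
  rintro x (⟨u, i, hi, j, hj, rfl⟩ | ⟨i, j, ⟨⟨u, h⟩, hij, -⟩, rfl⟩)
  · refine ⟨?_, _, D.comulHom_commElt hi hj⟩
    change E.counitHom _ = 0
    rw [commElt]
    split_ifs <;> simp [E.counitHom_gen, E.counitHom_grp]
  · rw [D.qSerre_χ_ξ]
    refine ⟨?_, _, D.comulHom_qSerre h hij⟩
    change E.counitHom _ = 0
    rw [map_qSerre]
    simp [E.counitHom_gen, qSerre]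

end LocalFLFree

/-! ### Comparison of the generators `E_j` and `X_j`. -/

namespace LocalFLFree

variable {k G J N : Type*} [Field k] [Group G] {E : ESC k G J} (D : LocalFLFree E N)

section Rescaling

variable {B : Type*} [Ring B] [Algebra k B] {φ : G →* B} {X : J → B}

theorem grp_mul_of_mul_grp (hX : ∀ j h, X j * φ h = (E.χ j h : k) • (φ h * X j)) (j : J) (h : G) :
    φ h * X j = (E.χ j h : k)⁻¹ • (X j * φ h) := by
  rw [hX, smul_smul, inv_mul_cancel₀ (Units.ne_zero _), one_smul]

open Classical in
-- The coefficients of `commElt` are exactly those that cancel the scalars from moving `rt i` past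
-- `X_j` and `rt j` past `X_i`. It is applied both in `U` and in the quotient by `I`.
theorem comm_rescale (hX : ∀ j h, X j * φ h = (E.χ j h : k) • (φ h * X j)) {u : N} {i j : J}
    (hi : i ∈ D.P u) (hj : j ∈ D.P' u) :
    (E.χ j (D.ξ i) : k) • (X i * φ (D.rt i) * (X j * φ (D.rt j)))
        - (E.χ i (D.ξ j) : k)⁻¹ • (X j * φ (D.rt j) * (X i * φ (D.rt i)))
        - (if D.σ i = j then (D.den i)⁻¹ • (φ (E.g i) ^ 2 - 1) else 0)
      = (X i * X j - X j * X i
        - if D.σ i = j then (D.den i)⁻¹ • (φ (D.ξ i) ^ 2 - φ (D.ξ (D.σ i)) ^ 2) else 0)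
          * φ (D.rt i * D.rt j) := by
  have h1 : X i * φ (D.rt i) * (X j * φ (D.rt j))
      = (E.χ j (D.ξ i) : k)⁻¹ • (X i * X j * φ (D.rt i * D.rt j)) := by
    rw [mul_assoc, ← mul_assoc _ (X j), grp_mul_of_mul_grp hX, smul_mul_assoc, mul_smul_comm,
      D.rt_eq (D.mem_J₁ hi), map_mul]
    simp only [mul_assoc]
  have h2 : X j * φ (D.rt j) * (X i * φ (D.rt i))
      = (E.χ i (D.ξ j) : k) • (X j * X i * φ (D.rt i * D.rt j)) := by
    rw [mul_assoc, ← mul_assoc _ (X i), grp_mul_of_mul_grp hX, smul_mul_assoc, mul_smul_comm,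
      D.group_comm (D.rt i), map_mul, D.rt_eq_inv hj, map_inv, Units.val_inv_eq_inv_val, inv_inv]
    simp only [mul_assoc]
  rw [h1, h2, smul_smul, smul_smul, mul_inv_cancel₀ (Units.ne_zero _),
    inv_mul_cancel₀ (Units.ne_zero _), one_smul, one_smul, sub_mul, sub_mul]
  congr 1
  split_ifs with hσ
  -- Now `rt i * rt j = ξ_i²`, and `g_i² - 1 = (ξ_i² - ξ_i⁻²) ξ_i²`.
  · subst hσ
    rw [smul_mul_assoc, D.rt_σ hi, D.rt_eq (D.mem_J₁ hi), D.g_eq u i hi, D.ξ_σ u i hi, sub_mul]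
    simp only [← map_pow, ← map_mul]
    congr 3
    · group
    · rw [← map_one φ]
      congr 1
      group
  · rw [zero_mul]

theorem qSerre_rescale (hX : ∀ j h, X j * φ h = (E.χ j h : k) • (φ h * X j)) {u : N} {i j : J}
    (h : (i ∈ D.P u ∧ j ∈ D.P u) ∨ (i ∈ D.P' u ∧ j ∈ D.P' u)) (q : k) (r : ℕ) :
    ∃ c : k, c ≠ 0 ∧ qSerre q r (X i * φ (D.rt i)) (X j * φ (D.rt j))
      = c • (qSerre q r (X i) (X j) * φ (D.rt i ^ r * D.rt j)) := by
  refine ⟨_, ?_, (qSerre_mul_twist (grp_mul_of_mul_grp hX i (D.rt i))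
    (grp_mul_of_mul_grp hX j (D.rt i)) ?_ ?_ q r).trans (by rw [map_mul, map_pow])⟩
  · exact Finset.prod_ne_zero_iff.2 fun l _ =>
      mul_ne_zero (pow_ne_zero _ (inv_ne_zero (Units.ne_zero _))) (inv_ne_zero (Units.ne_zero _))
  -- The symmetry `χ_i(rt j) = χ_j(rt i)` supplies the common `β` of `qSerre_mul_twist`.
  · rw [grp_mul_of_mul_grp hX, D.χ_rt_comm h]
  · rw [← map_mul, ← map_mul, D.group_comm]

theorem mul_grp_cancel {x : B} (h : G) : x * φ h = 0 ↔ x = 0 := by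
  refine ⟨fun hx => ?_, fun hx => by rw [hx, zero_mul]⟩
  rw [← mul_one x, ← map_one φ, ← mul_inv_cancel h, map_mul, ← mul_assoc, hx, zero_mul]

end Rescaling

/-! ### The relations of `U` -/

/-- The presentation of `U` as a quotient of the free algebra. -/
noncomputable def mkU : FreeAlgebra k (J ⊕ J) →ₐ[k] D.U := RingQuot.mkAlgHom k D.URel

theorem mkU_eq {x y : FreeAlgebra k (J ⊕ J)} (h : D.URel x y) : D.mkU x = D.mkU y :=
  RingQuot.mkAlgHom_rel k h

theorem mkU_freeK (i : J) : D.mkU (freeK k i) = D.K i := rfl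

theorem mkU_freeX (i : J) : D.mkU (freeX k i) = D.X i := rfl

theorem K_mul_K_σ {i : J} (hi : i ∈ D.J₁) : D.K i * D.K (D.σ i) = 1 := by
  simpa [mkU_freeK] using D.mkU_eq (.inv_right i hi)

theorem K_σ_mul_K {i : J} (hi : i ∈ D.J₁) : D.K (D.σ i) * D.K i = 1 := by
  simpa [mkU_freeK] using D.mkU_eq (.inv_left i hi)

theorem K_mul_comm (i j : J) : D.K i * D.K j = D.K j * D.K i := by
  simpa [mkU_freeK, sub_eq_zero] using D.mkU_eq (.KK i j)

theorem X_mul_K (i j : J) : D.X j * D.K i = (E.χ j (D.ξ i) : k) • (D.K i * D.X j) := by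
  simpa [mkU_freeK, mkU_freeX] using (D.mkU_eq (.KX i j)).symm

open Classical in
theorem X_comm {u : N} {i j : J} (hi : i ∈ D.P u) (hj : j ∈ D.P' u) :
    D.X i * D.X j - D.X j * D.X i
      = if D.σ i = j then (D.den i)⁻¹ • (D.K i ^ 2 - D.K (D.σ i) ^ 2) else 0 := by
  have h := D.mkU_eq (.comm u i j hi hj)
  rw [apply_ite D.mkU] at h
  simpa [mkU_freeK, mkU_freeX] using h

theorem qSerre_X {i j : J} (h : D.SerrePair i j) :
    qSerre (E.χ i (D.ξ i)⁻¹ : k) (D.r i j) (D.X i) (D.X j) = 0 := by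
  simpa only [map_qSerre, mkU_freeX, map_zero] using D.mkU_eq (.serre i j h)

theorem U_hom_ext {B : Type*} [Semiring B] [Algebra k B] {f f' : D.U →ₐ[k] B}
    (hK : ∀ i, f (D.K i) = f' (D.K i)) (hX : ∀ i, f (D.X i) = f' (D.X i)) : f = f' := by
  apply RingQuot.ringQuot_ext'
  ext x
  rcases x with i | i
  · exact hK i
  · exact hX i

/-- The homomorphism from `G` to `U` with `ξ_i ↦ K_i`. -/
noncomputable def grpU : G →* D.U :=
  (D.exists_groupHom D.K (fun i => D.K (D.σ i)) (fun _ => D.K_mul_K_σ) (fun _ => D.K_σ_mul_K)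
    (fun i _ j _ => D.K_mul_comm i j)).choose

theorem grpU_ξ_of_mem {i : J} (hi : i ∈ D.J₁) : D.grpU (D.ξ i) = D.K i :=
  (D.exists_groupHom D.K (fun i => D.K (D.σ i)) (fun _ => D.K_mul_K_σ) (fun _ => D.K_σ_mul_K)
    (fun i _ j _ => D.K_mul_comm i j)).choose_spec i hi

theorem grpU_ξ (i : J) : D.grpU (D.ξ i) = D.K i := by
  obtain ⟨u, hi | hi⟩ := D.cover i
  · exact D.grpU_ξ_of_mem (D.mem_J₁ hi)
  · obtain ⟨i, hi', rfl⟩ := D.exists_σ_eq hi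
    -- The image of `ξ_{σ(i)} = ξ_i⁻¹` and `K_{σ(i)}` are both inverses of `K_i`.
    refine left_inv_eq_right_inv ?_ (D.K_mul_K_σ (D.mem_J₁ hi'))
    rw [← D.grpU_ξ_of_mem (D.mem_J₁ hi'), ← map_mul, D.ξ_σ u i hi', inv_mul_cancel, map_one]

theorem X_mul_grpU (j : J) (h : G) : D.X j * D.grpU h = (E.χ j h : k) • (D.grpU h * D.X j) := by
  induction h using D.group_induction with
  | one => simp
  | gen i hi => rw [D.grpU_ξ, D.X_mul_K]
  | inv h ih =>
    have h1 : D.grpU h⁻¹ * D.grpU h = 1 := by rw [← map_mul, inv_mul_cancel, map_one]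
    have h2 : D.grpU h * D.grpU h⁻¹ = 1 := by rw [← map_mul, mul_inv_cancel, map_one]
    calc D.X j * D.grpU h⁻¹
        = (D.grpU h⁻¹ * D.grpU h) * D.X j * D.grpU h⁻¹ := by rw [h1, one_mul]
      _ = (E.χ j h : k)⁻¹ • (D.grpU h⁻¹ * (D.X j * D.grpU h) * D.grpU h⁻¹) := by
          rw [ih, mul_smul_comm, smul_mul_assoc, smul_smul, inv_mul_cancel₀ (Units.ne_zero _),
            one_smul]
          simp only [mul_assoc]
      _ = _ := by
          rw [mul_assoc, mul_assoc (D.X j), h2, mul_one, map_inv (E.χ j), Units.val_inv_eq_inv_val]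
  | mul x y hx hy =>
    rw [map_mul, ← mul_assoc, hx, smul_mul_assoc, mul_assoc, hy, mul_smul_comm, smul_smul,
      map_mul, Units.val_mul, mul_assoc]

/-! ### The isomorphism -/

/-- The homomorphism from the semi-path algebra to `U` with `h ↦ h` for `h ∈ G` and
`E_j ↦ X_j ξ` where `ξ² = g_j`. -/
noncomputable def toU : E.SemiPath →ₐ[k] D.U :=
  E.lift D.grpU (fun a => D.grpU a.src * (D.X a.idx * D.grpU (D.rt a.idx)))
    (fun h a => by
      change D.grpU (h * a.src) * _ = _
      rw [map_mul, mul_assoc]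
      rfl)
    (fun h a => by
      change _ • (D.grpU (a.src * h) * (D.X a.idx * D.grpU (D.rt a.idx))) = _
      have key : D.X a.idx * D.grpU (D.rt a.idx) * D.grpU h
          = (E.χ a.idx h : k) • (D.grpU h * (D.X a.idx * D.grpU (D.rt a.idx))) := by
        rw [mul_assoc, ← map_mul, D.group_comm, map_mul, ← mul_assoc, D.X_mul_grpU, smul_mul_assoc,
          mul_assoc]
      rw [mul_assoc, key, mul_smul_comm, map_mul, mul_assoc])

theorem toU_grp (h : G) : D.toU (E.grp h) = D.grpU h := E.lift_grp _ _ _ _ h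

theorem toU_gen (j : J) : D.toU (E.gen j) = D.X j * D.grpU (D.rt j) := by
  refine (E.lift_arr _ _ _ _ _).trans ?_
  rw [map_one, one_mul]

theorem toU_eq_zero (x : E.SemiPath) (hx : x ∈ D.I) : D.toU x = 0 := by
  refine map_eq_zero_of_mem_span D.toU ?_ hx
  rintro x (⟨u, i, hi, j, hj, rfl⟩ | ⟨i, j, h, rfl⟩)
  · rw [commElt, map_sub, map_sub, map_smul, map_smul, map_mul, map_mul, apply_ite D.toU, map_smul,
      map_sub, map_pow, map_one, map_zero, D.toU_gen, D.toU_gen, D.toU_grp,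
      D.comm_rescale D.X_mul_grpU hi hj, D.X_comm hi hj, D.grpU_ξ, D.grpU_ξ, sub_self, zero_mul]
  · obtain ⟨⟨u, hu⟩, -, -⟩ := id h
    obtain ⟨c, -, hc⟩ := D.qSerre_rescale D.X_mul_grpU hu (E.χ i (D.ξ i)⁻¹ : k) (D.r i j)
    rw [map_qSerre, D.toU_gen, D.toU_gen, hc, D.qSerre_X h, zero_mul, smul_zero]

/-- The images of the generators `X_j` of `U` in the quotient of the semi-path algebra. -/
noncomputable def quotX (j : J) : E.SemiPath ⧸ D.I :=
  Ideal.Quotient.mkₐ k D.I (E.gen j * E.grp (D.rt j)⁻¹)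

/-- The homomorphism from `G` to the quotient of the semi-path algebra. -/
noncomputable def quotGrp : G →* E.SemiPath ⧸ D.I :=
  (Ideal.Quotient.mkₐ k D.I : E.SemiPath →* E.SemiPath ⧸ D.I).comp E.grp

theorem quotGrp_apply (h : G) : D.quotGrp h = Ideal.Quotient.mkₐ k D.I (E.grp h) := rfl

theorem quotX_mul_quotGrp (j : J) (h : G) :
    D.quotX j * D.quotGrp h = (E.χ j h : k) • (D.quotGrp h * D.quotX j) := by
  rw [quotX, quotGrp_apply, ← map_mul, ← map_mul, ← map_smul, mul_assoc, ← map_mul E.grp,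
    D.group_comm, map_mul E.grp, ← mul_assoc, E.gen_mul_grp, smul_mul_assoc, mul_assoc]

theorem quotX_mul_rt (j : J) :
    D.quotX j * D.quotGrp (D.rt j) = Ideal.Quotient.mkₐ k D.I (E.gen j) := by
  rw [quotX, quotGrp_apply, ← map_mul, mul_assoc, ← map_mul, inv_mul_cancel, map_one, mul_one]

theorem mk_commElt {u : N} {i j : J} (hi : i ∈ D.P u) (hj : j ∈ D.P' u) :
    Ideal.Quotient.mkₐ k D.I (D.commElt i j) = 0 :=
  Ideal.Quotient.eq_zero_iff_mem.2 (TwoSidedIdeal.subset_span (.inl ⟨u, i, hi, j, hj, rfl⟩))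

theorem mk_qSerre {i j : J} (h : D.SerrePair i j) : Ideal.Quotient.mkₐ k D.I
    (qSerre (E.χ i (D.ξ i)⁻¹ : k) (D.r i j) (E.gen i) (E.gen j)) = 0 :=
  Ideal.Quotient.eq_zero_iff_mem.2 (TwoSidedIdeal.subset_span (.inr ⟨i, j, h, rfl⟩))

open Classical in
theorem quotX_comm {u : N} {i j : J} (hi : i ∈ D.P u) (hj : j ∈ D.P' u) :
    D.quotX i * D.quotX j - D.quotX j * D.quotX i = if D.σ i = j then
      (D.den i)⁻¹ • (D.quotGrp (D.ξ i) ^ 2 - D.quotGrp (D.ξ (D.σ i)) ^ 2) else 0 := by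
  -- Multiplying by an invertible group element turns the claim into the vanishing of the class of
  -- `commElt`.
  rw [← sub_eq_zero, ← mul_grp_cancel (φ := D.quotGrp) (D.rt i * D.rt j),
    ← D.comm_rescale D.quotX_mul_quotGrp hi hj]
  refine Eq.trans ?_ (D.mk_commElt hi hj)
  rw [commElt, map_sub, map_sub,
    map_smul, map_smul, map_mul, map_mul, apply_ite (Ideal.Quotient.mkₐ k D.I), map_smul,
    map_sub, map_pow, map_one, map_zero, D.quotX_mul_rt, D.quotX_mul_rt, D.quotGrp_apply]

theorem qSerre_quotX {i j : J} (h : D.SerrePair i j) :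
    qSerre (E.χ i (D.ξ i)⁻¹ : k) (D.r i j) (D.quotX i) (D.quotX j) = 0 := by
  obtain ⟨⟨u, hu⟩, -, -⟩ := id h
  obtain ⟨c, hc0, hc⟩ := D.qSerre_rescale D.quotX_mul_quotGrp hu (E.χ i (D.ξ i)⁻¹ : k) (D.r i j)
  rw [D.quotX_mul_rt, D.quotX_mul_rt, ← map_qSerre, D.mk_qSerre h] at hc
  exact (mul_grp_cancel _).1 ((smul_eq_zero_iff_right hc0).1 hc.symm)

/-- The homomorphism from the free algebra defining the inverse isomorphism. -/
noncomputable def freeToQuot : FreeAlgebra k (J ⊕ J) →ₐ[k] E.SemiPath ⧸ D.I :=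
  FreeAlgebra.lift k (Sum.elim (fun i => D.quotGrp (D.ξ i)) D.quotX)

theorem freeToQuot_freeK (i : J) : D.freeToQuot (freeK k i) = D.quotGrp (D.ξ i) := by
  simp [freeToQuot, freeK]

theorem freeToQuot_freeX (i : J) : D.freeToQuot (freeX k i) = D.quotX i := by
  simp [freeToQuot, freeX]

theorem freeToQuot_rel {x y : FreeAlgebra k (J ⊕ J)} (h : D.URel x y) :
    D.freeToQuot x = D.freeToQuot y := by
  induction h with
  | comm u i j hi hj =>
    rw [apply_ite D.freeToQuot]
    simp only [map_sub, map_mul, map_smul, map_pow, map_zero, freeToQuot_freeK, freeToQuot_freeX]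
    exact D.quotX_comm hi hj
  | inv_right i hi =>
    obtain ⟨u, hu⟩ := Set.mem_iUnion.1 hi
    rw [map_mul, D.freeToQuot_freeK, D.freeToQuot_freeK, ← map_mul, D.ξ_σ u i hu, mul_inv_cancel,
      map_one, map_one]
  | inv_left i hi =>
    obtain ⟨u, hu⟩ := Set.mem_iUnion.1 hi
    rw [map_mul, D.freeToQuot_freeK, D.freeToQuot_freeK, ← map_mul, D.ξ_σ u i hu, inv_mul_cancel,
      map_one, map_one]
  | KX i j =>
    rw [map_smul, map_mul, map_mul, D.freeToQuot_freeK, D.freeToQuot_freeX, D.quotX_mul_quotGrp]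
  | KK i j =>
    rw [map_sub, map_mul, map_mul, D.freeToQuot_freeK, D.freeToQuot_freeK, ← map_mul, ← map_mul,
      D.group_comm, sub_self, map_zero]
  | serre i j h =>
    rw [map_qSerre, D.freeToQuot_freeX, D.freeToQuot_freeX, D.qSerre_quotX h, map_zero]

/-- The inverse isomorphism. -/
noncomputable def ofU : D.U →ₐ[k] E.SemiPath ⧸ D.I :=
  RingQuot.liftAlgHom k ⟨D.freeToQuot, fun _ _ => D.freeToQuot_rel⟩

theorem ofU_K (i : J) : D.ofU (D.K i) = D.quotGrp (D.ξ i) :=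
  (RingQuot.liftAlgHom_mkAlgHom_apply k _ _ _).trans (D.freeToQuot_freeK i)

theorem ofU_X (i : J) : D.ofU (D.X i) = D.quotX i :=
  (RingQuot.liftAlgHom_mkAlgHom_apply k _ _ _).trans (D.freeToQuot_freeX i)

theorem ofU_grpU (h : G) : D.ofU (D.grpU h) = D.quotGrp h := by
  induction h using D.group_induction with
  | one => simp
  | gen i hi => rw [D.grpU_ξ, D.ofU_K]
  | inv h ih =>
    refine left_inv_eq_right_inv (a := D.quotGrp h) ?_ ?_
    · rw [← ih, ← map_mul, ← map_mul, inv_mul_cancel, map_one, map_one]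
    · rw [← map_mul, mul_inv_cancel, map_one]
  | mul x y hx hy => rw [map_mul, map_mul, hx, hy, map_mul]

/-- The isomorphism of algebras between the quotient of the semi-path algebra and `U`. -/
noncomputable def quotEquiv : (E.SemiPath ⧸ D.I) ≃ₐ[k] D.U :=
  AlgEquiv.ofAlgHom (Ideal.Quotient.liftₐ D.I D.toU D.toU_eq_zero) D.ofU
    (D.U_hom_ext
      (fun i => by
        rw [AlgHom.comp_apply, D.ofU_K]
        exact (D.toU_grp _).trans (D.grpU_ξ i))
      (fun i => by
        rw [AlgHom.comp_apply, D.ofU_X]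
        refine (map_mul D.toU _ _).trans ?_
        rw [D.toU_gen, D.toU_grp, mul_assoc, ← map_mul, mul_inv_cancel, map_one, mul_one]
        rfl))
    (Ideal.Quotient.algHom_ext k (ESC.hom_ext
      (fun h => by
        refine (congrArg D.ofU (D.toU_grp h)).trans ?_
        exact D.ofU_grpU h)
      (fun a => by
        rw [E.arr_eq, map_mul, map_mul]
        refine congrArg₂ (· * ·) ((congrArg D.ofU (D.toU_grp _)).trans (D.ofU_grpU _))
          ((congrArg D.ofU (D.toU_gen _)).trans ?_)
        rw [map_mul, D.ofU_X, D.ofU_grpU, D.quotX_mul_rt]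
        rfl)))

theorem quotEquiv_mk (x : E.SemiPath) : D.quotEquiv (Ideal.Quotient.mk D.I x) = D.toU x := rfl

theorem K_eq_quotEquiv (i : J) : D.K i = D.quotEquiv (Ideal.Quotient.mk D.I (E.grp (D.ξ i))) := by
  rw [D.quotEquiv_mk, D.toU_grp, D.grpU_ξ]

theorem X_eq_quotEquiv (i : J) :
    D.X i = D.quotEquiv (Ideal.Quotient.mk D.I (E.gen i * E.grp (D.rt i)⁻¹)) := by
  rw [D.quotEquiv_mk, map_mul, D.toU_gen, D.toU_grp, mul_assoc, ← map_mul, mul_inv_cancel, map_one,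
    mul_one]

/-! ### The transported Hopf structure on the generators of `U`. -/

section Standard

variable [D.I.IsHopfIdeal k]

theorem comul_quotEquiv_mk (x : E.SemiPath) :
    (HopfStructure.ofAlgEquiv D.quotEquiv).comul (D.quotEquiv (Ideal.Quotient.mk D.I x))
      = Algebra.TensorProduct.map D.toU D.toU (E.comulHom x) := by
  rw [HopfStructure.ofAlgEquiv_comul, Bialgebra.Quotient.comul_mk]
  change _ = Algebra.TensorProduct.map D.toU D.toU (Coalgebra.comul (R := k) x)
  induction (Coalgebra.comul (R := k) x) with
  | zero => simp
  | add x y hx hy => simp only [map_add, hx, hy]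
  | tmul x y => rfl

theorem counit_quotEquiv_mk (x : E.SemiPath) :
    (HopfStructure.ofAlgEquiv D.quotEquiv).counit (D.quotEquiv (Ideal.Quotient.mk D.I x))
      = E.counitHom x :=
  HopfStructure.ofAlgEquiv_counit _ _

theorem antipode_quotEquiv_mk (x : E.SemiPath) :
    (HopfStructure.ofAlgEquiv D.quotEquiv).antipode (D.quotEquiv (Ideal.Quotient.mk D.I x))
      = D.toU (E.antipodeMap x) :=
  HopfStructure.ofAlgEquiv_antipode _ _

/-- Multiply `Δ(E_j) = g_j ⊗ E_j + E_j ⊗ 1` by `(rt j)⁻¹ ⊗ (rt j)⁻¹` and use `g_j = (rt j)²`. As `rt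
(σ j) = rt j` for `j ∈ J^(1)`, the same `K_j` and `K_{σ(j)}` occur for `X_j` and `X_{σ(j)}`. -/
theorem comul_X (j : J) : (HopfStructure.ofAlgEquiv D.quotEquiv).comul (D.X j)
    = D.X j ⊗ₜ D.grpU (D.rt j)⁻¹ + D.grpU (D.rt j) ⊗ₜ D.X j := by
  have h1 : D.toU (E.grp (E.g j) * E.grp (D.rt j)⁻¹) = D.grpU (D.rt j) := by
    rw [← map_mul, D.toU_grp, D.g_eq_rt]
    congr 1
    group
  have h2 : D.toU (E.gen j * E.grp (D.rt j)⁻¹) = D.X j := by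
    rw [D.X_eq_quotEquiv, D.quotEquiv_mk]
  rw [D.X_eq_quotEquiv, D.comul_quotEquiv_mk, map_mul, E.comulHom_gen, E.comulHom_grp, add_mul,
    Algebra.TensorProduct.tmul_mul_tmul, Algebra.TensorProduct.tmul_mul_tmul, one_mul, map_add,
    Algebra.TensorProduct.map_tmul, Algebra.TensorProduct.map_tmul, h1, h2, D.toU_grp, add_comm,
    ← D.X_eq_quotEquiv]

/-- In the semi-path algebra `S(E_j (rt j)⁻¹) = -(rt j) g_j⁻¹ E_j = -(rt j)⁻¹ E_j`; moving the group
element back to the right produces the scalar `χ_j(rt j)`. -/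
theorem antipode_X (j : J) : (HopfStructure.ofAlgEquiv D.quotEquiv).antipode (D.X j)
    = -((E.χ j (D.rt j) : k) • D.X j) := by
  rw [D.X_eq_quotEquiv, D.antipode_quotEquiv_mk, E.antipodeMap_mul, E.antipodeMap_gen,
    E.antipodeMap_grp, inv_inv, mul_neg, ← mul_assoc, ← map_mul, map_neg, D.quotEquiv_mk,
    E.gen_mul_grp, map_smul, smul_smul, ← Units.val_mul, ← map_mul, mul_inv_cancel, map_one,
    Units.val_one, one_smul, D.g_eq_rt]
  congr 4
  group

theorem isStandard : D.IsStandard (HopfStructure.ofAlgEquiv D.quotEquiv) where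
  comul_X j hj := by
    obtain ⟨u, hu⟩ := Set.mem_iUnion.1 hj
    rw [D.comul_X, D.rt_eq hj, ← D.ξ_σ u j hu, D.grpU_ξ, D.grpU_ξ]
  comul_X_σ j hj := by
    obtain ⟨u, hu⟩ := Set.mem_iUnion.1 hj
    rw [D.comul_X, D.rt_σ hu, ← D.ξ_σ u j hu, D.grpU_ξ, D.grpU_ξ]
  comul_K i := by
    rw [D.K_eq_quotEquiv, D.comul_quotEquiv_mk, E.comulHom_grp, Algebra.TensorProduct.map_tmul,
      D.quotEquiv_mk]
  counit_X i := by
    rw [D.X_eq_quotEquiv, D.counit_quotEquiv_mk, map_mul, E.counitHom_gen, zero_mul]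
  counit_K i := by rw [D.K_eq_quotEquiv, D.counit_quotEquiv_mk, E.counitHom_grp]
  antipode_X j hj := by rw [D.antipode_X, D.rt_eq hj]
  antipode_X_σ j hj := by
    obtain ⟨u, hu⟩ := Set.mem_iUnion.1 hj
    rw [D.antipode_X, D.rt_σ hu]
  antipode_K j hj := by
    obtain ⟨u, hu⟩ := Set.mem_iUnion.1 hj
    rw [D.K_eq_quotEquiv, D.antipode_quotEquiv_mk, E.antipodeMap_grp, D.toU_grp, ← D.ξ_σ u j hu,
      D.grpU_ξ]

end Standard

end LocalFLFree

theorem theorem7 {k G J N : Type*} [Field k] [Group G] (E : ESC k G J) (D : LocalFLFree E N)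
    (hden : ∀ i ∈ D.J₁, (E.χ i (D.ξ i) : k) - (E.χ i (D.ξ i) : k)⁻¹ ≠ 0) :
    ∃ (_ : D.I.IsHopfIdeal k) (H : HopfStructure k D.U), D.IsStandard H ∧
      letI := H.toHopfAlgebra
      Nonempty ((E.SemiPath ⧸ D.I) ≃ₐc[k] D.U) := by
  have := D.isHopfIdeal_I
  exact ⟨this, HopfStructure.ofAlgEquiv D.quotEquiv, D.isStandard,
    HopfStructure.nonempty_bialgEquiv_ofAlgEquiv D.quotEquiv⟩
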